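/- Boolean functions on $N$ variables are maps $\{-1,1\}^N\to\{-1,1\}$. A threshold gate with $m$ incoming wires is labelled by $w\in\mathbb{R}^m$ and $\theta\in\mathbb{R}$ and outputs $\mathrm{sgn}(\langle w,x\rangle-\theta)$, where $\mathrm{sgn}(0)=-1$; its fan-in is $m$. It is an unweighted majority gate if $|w_i|=1$ for all $i$. A $\mathrm{MAJ}\circ\mathrm{THR}\circ\mathrm{THR}$ circuit on $N$ variables consists of a bottom layer of threshold gates reading the variables, a middle layer of threshold gates reading bottom gates, and one output gate, an unweighted majority gate, reading middle gates; there is at most one wire from a given source to a given gate. Its number of gates counts all gates (not the variables), and its number of wires is the sum of all fan-ins. **Theorem.** There are a function $f:\{-1,1\}^*\to\{-1,1\}$ computable by a Turing machine in time polynomial in the length of the input, and a function $\varepsilon:\mathbb{N}\to\mathbb{R}$ with $\varepsilon(n)\to 0$ as $n\to\infty$, such that for infinitely many $n\in\mathbb{N}$ the following holds: every $\mathrm{MAJ}\circ\mathrm{THR}\circ\mathrm{THR}$ circuit on $2n$ variables that computes the restriction of $f$ to $\{-1,1\}^{2n}$ has at least $n^{1.5-\varepsilon(n)}$ gates and at least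 $n^{2.5-\varepsilon(n)}$ wires. -/

import Mathlib

open Filter Topology

/-- Boolean values are `true` and `false`; as real numbers they stand for `1` and `-1`. -/
def boolSign (b : Bool) : ℝ := if b then 1 else -1

/-- A threshold gate reading from a pool `ι` of possible sources (input variables, or gates of the
layer below). Its label is `(w, θ)`, where `w` is `weight` restricted to the set `inputs` of sources
that are wired to the gate; there is at most one wire from each source. -/
structure ThresholdGate (ι : Type) where
  inputs : Finset ι
  weight : ι → ℝ
  threshold : ℝ

namespace ThresholdGate

variable {ι : Type}

/-- The fan-in of a gate is the number of its incoming wires. -/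
def fanIn (φ : ThresholdGate ι) : ℕ := φ.inputs.card

open Classical in
/-- The gate computes `sgn (⟨w, x⟩ - θ)`, where `sgn 0 = -1`. -/
noncomputable def eval (φ : ThresholdGate ι) (x : ι → Bool) : Bool :=
  decide (0 < (∑ i ∈ φ.inputs, φ.weight i * boolSign (x i)) - φ.threshold)

/-- An unweighted majority gate is a threshold gate all of whose weights are `1` or `-1`. -/
def IsUnweightedMajority (φ : ThresholdGate ι) : Prop :=
  ∀ i ∈ φ.inputs, |φ.weight i| = 1

end ThresholdGate

/-- A `MAJ ∘ THR ∘ THR` circuit on `N` variables: an unweighted majority gate above two layers of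
general threshold gates. The bottom gates read the variables, the middle gates read the bottom
gates and the output gate reads the middle gates. Fan-outs are unrestricted. -/
structure MajThrThrCircuit (N : ℕ) where
  numBottom : ℕ
  numMiddle : ℕ
  bottom : Fin numBottom → ThresholdGate (Fin N)
  middle : Fin numMiddle → ThresholdGate (Fin numBottom)
  top : ThresholdGate (Fin numMiddle)
  top_majority : top.IsUnweightedMajority

namespace MajThrThrCircuit

variable {N : ℕ}

/-- The Boolean function computed by the circuit. -/
noncomputable def eval (C : MajThrThrCircuit N) (x : Fin N → Bool) : Bool :=
  C.top.eval fun j => (C.middle j).eval fun i => (C.bottom i).eval x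

/-- The gate complexity: the number of gates (input variables are not counted). -/
def gates (C : MajThrThrCircuit N) : ℕ := C.numBottom + C.numMiddle + 1

/-- The wire complexity: the sum of the fan-ins of all the gates. -/
def wires (C : MajThrThrCircuit N) : ℕ :=
  (∑ i, (C.bottom i).fanIn) + (∑ j, (C.middle j).fanIn) + C.top.fanIn

/-- The circuit computes the Boolean function `g`. -/
def Computes (C : MajThrThrCircuit N) (g : (Fin N → Bool) → Bool) : Prop :=
  ∀ x, C.eval x = g x

end MajThrThrCircuit

/-- `f : {0,1}* → {0,1}` is computable by a Turing machine in time polynomial in the length of its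
input. The input word is presented as it is, and the output is the one-bit word `f x`. -/
def PolyTimeComputable (f : List Bool → Bool) : Prop :=
  Nonempty (Turing.TM2ComputableInPolyTime (id : List Bool → List Bool) Computability.encodeBool f)

/-- The Boolean function on `N` variables obtained from `f` by considering inputs of length `N`. -/
def slice (f : List Bool → Bool) (N : ℕ) (x : Fin N → Bool) : Bool := f (List.ofFn x)

set_option linter.unusedSectionVars false

/-- The state of a linear feedback shift register that evaluates a sum of message bits against its
output sequence. The list `reg` consists of the pairs (tap, current bit), the oldest bit first;
`tap` and `bit` are the entries of the next pair to be loaded. -/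
structure ShiftRegister where
  tap : Bool
  bit : Bool
  acc : Bool
  reg : List (Bool × Bool)

namespace ShiftRegister

/-- Adds to `c` the products of the taps and the current bits. -/
def feedback : Bool → List (Bool × Bool) → Bool
  | c, [] => c
  | c, (a, s) :: l => feedback (xor c (a && s)) l

/-- Runs through a register from its newest bit to its oldest bit, replacing each bit by the one
met before; the first component of the result is the bit that is shifted out. -/
def shift : Bool → List (Bool × Bool) → List (Bool × Bool) → Bool × List (Bool × Bool)
  | c, [], r => (c, r)
  | c, (a, s) :: l, r => shift s l ((a, c) :: r)

/-- The effect of one input symbol. -/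
def step (S : ShiftRegister) : Bool → Bool → Bool → ShiftRegister
  | false, false, d => { S with tap := xor S.tap d }
  | false, true, d => { S with bit := xor S.bit d }
  | true, false, _ => ⟨false, false, S.acc, (S.tap, S.bit) :: S.reg⟩
  | true, true, d =>
    { S with
      acc := xor S.acc (d && (shift (feedback false S.reg) S.reg.reverse []).1)
      reg := (shift (feedback false S.reg) S.reg.reverse []).2 }

/-- Reads an input word in symbols of three bits. -/
def run : ShiftRegister → List Bool → ShiftRegister
  | S, c₁ :: c₂ :: d :: w => run (S.step c₁ c₂ d) w
  | S, _ => S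

/-- The Boolean function computed by the register. -/
def output (w : List Bool) : Bool := (run ⟨false, false, false, []⟩ w).acc

end ShiftRegister

namespace ShiftRegisterMachine

open Turing Turing.TM2.Stmt

inductive Label
  | read | forward | back | clean
  deriving DecidableEq

instance : Fintype Label where
  elems := {.read, .forward, .back, .clean}
  complete l := by cases l <;> simp

structure Vars where
  tap : Bool
  bit : Bool
  acc : Bool
  carry : Bool
  x₁ : Option Bool
  x₂ : Option Bool
  x₃ : Option Bool

noncomputable instance : Fintype Vars :=
  Fintype.ofInjective (fun v => (v.tap, v.bit, v.acc, v.carry, v.x₁, v.x₂, v.x₃)) fun v v' h => by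
    cases v; cases v'; simpa using h

def Vars.init : Vars := ⟨false, false, false, false, none, none, none⟩

/-- The program. Stack `0` holds the input, stack `1` the register, and stack `2` the part of the
register that was run through. -/
def program : Label → TM2.Stmt (fun _ : Fin 3 => Bool) Label Vars
  | .read =>
    pop 0 (fun v o => { v with x₁ := o }) <|
    pop 0 (fun v o => { v with x₂ := o }) <|
    pop 0 (fun v o => { v with x₃ := o }) <|
    branch (fun v => v.x₃.isNone) (goto fun _ => .clean) <|
    branch (fun v => v.x₁ == some true)
      (branch (fun v => v.x₂ == some true)
        (load (fun v => { v with carry := false }) <| goto fun _ => .forward)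
        (push 1 (fun v => v.bit) <| push 1 (fun v => v.tap) <|
          load (fun v => { v with tap := false, bit := false }) <| goto fun _ => .read))
      (branch (fun v => v.x₂ == some true)
        (load (fun v => { v with bit := xor v.bit (v.x₃ == some true) }) <| goto fun _ => .read)
        (load (fun v => { v with tap := xor v.tap (v.x₃ == some true) }) <| goto fun _ => .read))
  | .forward =>
    pop 1 (fun v o => { v with x₁ := o }) <|
    pop 1 (fun v o => { v with x₂ := o }) <|
    branch (fun v => v.x₂.isNone) (goto fun _ => .back) <|
    load (fun v => { v with carry := xor v.carry (v.x₁ == some true && v.x₂ == some true) }) <|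
    push 2 (fun v => v.x₂ == some true) <| push 2 (fun v => v.x₁ == some true) <|
    goto fun _ => .forward
  | .back =>
    pop 2 (fun v o => { v with x₁ := o }) <|
    pop 2 (fun v o => { v with x₂ := o }) <|
    branch (fun v => v.x₂.isNone)
      (load (fun v => { v with acc := xor v.acc (v.x₃ == some true && v.carry) }) <|
        goto fun _ => .read) <|
    push 1 (fun v => v.carry) <| push 1 (fun v => v.x₁ == some true) <|
    load (fun v => { v with carry := v.x₂ == some true }) <|
    goto fun _ => .back
  | .clean =>
    pop 1 (fun v o => { v with x₁ := o }) <|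
    branch (fun v => v.x₁.isNone)
      (push 0 (fun v => v.acc) <| load (fun _ => Vars.init) halt)
      (goto fun _ => .clean)

/-- The machine that computes `ShiftRegister.output`. -/
noncomputable def machine : FinTM2 where
  K := Fin 3
  k₀ := 0
  k₁ := 0
  Γ _ := Bool
  Λ := Label
  main := .read
  σ := Vars
  initialState := Vars.init
  Γk₀Fin := inferInstanceAs (Fintype Bool)
  m := program

abbrev Config := TM2.Cfg (fun _ : Fin 3 => Bool) Label Vars

/-- A configuration is reached from another one in at most the given number of steps. -/
def Reach (a b : Config) (m : ℕ) : Prop :=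
  Nonempty (StateTransition.EvalsToInTime (TM2.step program) a (some b) m)

theorem Reach.refl (a : Config) : Reach a a 0 := ⟨.refl _ _⟩

theorem Reach.trans {a b c : Config} {m₁ m₂ : ℕ} (h₁ : Reach a b m₁) (h₂ : Reach b c m₂) :
    Reach a c (m₂ + m₁) :=
  let ⟨h₁⟩ := h₁
  let ⟨h₂⟩ := h₂
  ⟨.trans _ _ _ _ _ _ h₁ h₂⟩

theorem Reach.mono {a b : Config} {m₁ m₂ : ℕ} (h₁ : Reach a b m₁) (h : m₁ ≤ m₂) : Reach a b m₂ :=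
  let ⟨h₁⟩ := h₁
  ⟨⟨h₁.toEvalsTo, h₁.steps_le_m.trans h⟩⟩

theorem Reach.head {l : Label} {v : Vars} {S : Fin 3 → List Bool} {b c : Config} {m : ℕ}
    (h : TM2.stepAux (program l) v S = b) (h₂ : Reach b c m) : Reach ⟨some l, v, S⟩ c (m + 1) :=
  Reach.trans ⟨⟨⟨1, by simp [flip, TM2.step, h]⟩, le_rfl⟩⟩ h₂

theorem Reach.single {l : Label} {v : Vars} {S : Fin 3 → List Bool} {b : Config}
    (h : TM2.stepAux (program l) v S = b) : Reach ⟨some l, v, S⟩ b 1 :=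
  Reach.head h (Reach.refl b)

/-- The three stacks. -/
def threeStacks (s₀ s₁ s₂ : List Bool) : Fin 3 → List Bool
  | 0 => s₀
  | 1 => s₁
  | 2 => s₂

@[simp] theorem threeStacks_zero (s₀ s₁ s₂ : List Bool) : threeStacks s₀ s₁ s₂ 0 = s₀ := rfl
@[simp] theorem threeStacks_one (s₀ s₁ s₂ : List Bool) : threeStacks s₀ s₁ s₂ 1 = s₁ := rfl
@[simp] theorem threeStacks_two (s₀ s₁ s₂ : List Bool) : threeStacks s₀ s₁ s₂ 2 = s₂ := rfl

@[simp] theorem update_threeStacks_zero (s₀ s₁ s₂ s : List Bool) :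
    Function.update (threeStacks s₀ s₁ s₂) 0 s = threeStacks s s₁ s₂ := by
  funext k; fin_cases k <;> rfl

@[simp] theorem update_threeStacks_one (s₀ s₁ s₂ s : List Bool) :
    Function.update (threeStacks s₀ s₁ s₂) 1 s = threeStacks s₀ s s₂ := by
  funext k; fin_cases k <;> rfl

@[simp] theorem update_threeStacks_two (s₀ s₁ s₂ s : List Bool) :
    Function.update (threeStacks s₀ s₁ s₂) 2 s = threeStacks s₀ s₁ s := by
  funext k; fin_cases k <;> rfl

/-- The word that represents a register on a stack. -/
def flat : List (Bool × Bool) → List Bool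
  | [] => []
  | (a, s) :: l => a :: s :: flat l

theorem reach_forward (l : List (Bool × Bool)) (v : Vars) (w : List Bool) (r : List (Bool × Bool)) :
    ∃ x₁ x₂, Reach ⟨some .forward, v, threeStacks w (flat l) (flat r)⟩
      ⟨some .back, { v with carry := ShiftRegister.feedback v.carry l, x₁ := x₁, x₂ := x₂ },
        threeStacks w [] (flat (l.reverse ++ r))⟩ (l.length + 1) := by
  induction l generalizing v r with
  | nil => exact ⟨none, none, .single (by simp [program, flat, ShiftRegister.feedback])⟩
  | cons p l ih =>
    obtain ⟨a, s⟩ := p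
    obtain ⟨x₁, x₂, h⟩ := ih { v with carry := xor v.carry (a && s), x₁ := some a, x₂ := some s }
      ((a, s) :: r)
    refine ⟨x₁, x₂, ?_⟩
    simp only [List.reverse_cons, List.append_assoc, List.singleton_append, List.length_cons]
    exact .head (by simp [program, flat]) h

theorem reach_back (l : List (Bool × Bool)) (v : Vars) (w : List Bool) (r : List (Bool × Bool)) :
    ∃ x₁ x₂, Reach ⟨some .back, v, threeStacks w (flat r) (flat l)⟩
      ⟨some .read, { v with
        carry := (ShiftRegister.shift v.carry l r).1
        acc := xor v.acc (v.x₃ == some true && (ShiftRegister.shift v.carry l r).1)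
        x₁ := x₁, x₂ := x₂ },
        threeStacks w (flat (ShiftRegister.shift v.carry l r).2) []⟩ (l.length + 1) := by
  induction l generalizing v r with
  | nil => exact ⟨none, none, .single (by simp [program, flat, ShiftRegister.shift])⟩
  | cons p l ih =>
    obtain ⟨a, s⟩ := p
    obtain ⟨x₁, x₂, h⟩ := ih { v with carry := s, x₁ := some a, x₂ := some s } ((a, v.carry) :: r)
    refine ⟨x₁, x₂, ?_⟩
    exact .head (by simp [program, flat]) h

theorem reach_clean (l : List Bool) (v : Vars) :
    Reach ⟨some .clean, v, threeStacks [] l []⟩ ⟨none, Vars.init, threeStacks [v.acc] [] []⟩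
      (l.length + 1) := by
  induction l generalizing v with
  | nil => exact .single (by simp [program])
  | cons a l ih => exact .head (by simp [program]) (ih { v with x₁ := some a })

theorem length_shift (c : Bool) (l r : List (Bool × Bool)) :
    (ShiftRegister.shift c l r).2.length = l.length + r.length := by
  induction l generalizing c r with
  | nil => simp [ShiftRegister.shift]
  | cons p l ih => simp [ShiftRegister.shift, ih]; omega

theorem length_flat (l : List (Bool × Bool)) : (flat l).length = 2 * l.length := by
  induction l with
  | nil => rfl
  | cons p l ih => simp [flat, ih]; omega

theorem reach_symbol (S : ShiftRegister) (c₁ c₂ d : Bool) (w : List Bool) (v : Vars)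
    (ht : v.tap = S.tap) (hb : v.bit = S.bit) (ha : v.acc = S.acc) :
    ∃ v' : Vars, v'.tap = (S.step c₁ c₂ d).tap ∧ v'.bit = (S.step c₁ c₂ d).bit ∧
      v'.acc = (S.step c₁ c₂ d).acc ∧
      Reach ⟨some .read, v, threeStacks (c₁ :: c₂ :: d :: w) (flat S.reg) []⟩
        ⟨some .read, v', threeStacks w (flat (S.step c₁ c₂ d).reg) []⟩ (2 * S.reg.length + 3) := by
  obtain ⟨tap, bit, acc, reg⟩ := S
  simp only at ht hb ha
  subst ht hb ha
  cases c₁ <;> cases c₂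
  · refine ⟨{ v with tap := xor v.tap d, x₁ := some false, x₂ := some false, x₃ := some d },
      rfl, rfl, rfl, (Reach.single ?_).mono (by omega)⟩
    simp [program, ShiftRegister.step]
  · refine ⟨{ v with bit := xor v.bit d, x₁ := some false, x₂ := some true, x₃ := some d },
      rfl, rfl, rfl, (Reach.single ?_).mono (by omega)⟩
    simp [program, ShiftRegister.step]
  · refine ⟨{ v with tap := false, bit := false, x₁ := some true, x₂ := some false, x₃ := some d },
      rfl, rfl, rfl, (Reach.single ?_).mono (by omega)⟩
    simp [program, ShiftRegister.step, flat]
  · obtain ⟨x₁, x₂, h₁⟩ := reach_forward reg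
      { v with carry := false, x₁ := some true, x₂ := some true, x₃ := some d } w []
    obtain ⟨y₁, y₂, h₂⟩ := reach_back reg.reverse
      { v with carry := ShiftRegister.feedback false reg, x₁ := x₁, x₂ := x₂, x₃ := some d } w []
    rw [List.append_nil] at h₁
    refine ⟨_, ?_, ?_, ?_, Reach.mono (.head (by simp [program]; rfl) (h₁.trans h₂))
      (by rw [List.length_reverse]; dsimp only; omega)⟩
    · rfl
    · rfl
    · simp [ShiftRegister.step]

theorem length_reg_step_le (S : ShiftRegister) (c₁ c₂ d : Bool) :
    (S.step c₁ c₂ d).reg.length ≤ S.reg.length + 1 := by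
  cases c₁ <;> cases c₂ <;> simp [ShiftRegister.step, length_shift]

theorem reach_run (w : List Bool) (S : ShiftRegister) (v : Vars)
    (ht : v.tap = S.tap) (hb : v.bit = S.bit) (ha : v.acc = S.acc) :
    Reach ⟨some .read, v, threeStacks w (flat S.reg) []⟩
      ⟨none, Vars.init, threeStacks [(S.run w).acc] [] []⟩
      ((w.length + 1) * (2 * (S.reg.length + w.length) + 3)) := by
  have short (o₁ o₂ : Option Bool) (w : List Bool) (hw : (S.run w).acc = S.acc)
      (h : TM2.stepAux (program .read) v (threeStacks w (flat S.reg) []) =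
        ⟨some .clean, { v with x₁ := o₁, x₂ := o₂, x₃ := none }, threeStacks [] (flat S.reg) []⟩) :
      Reach ⟨some .read, v, threeStacks w (flat S.reg) []⟩
        ⟨none, Vars.init, threeStacks [(S.run w).acc] [] []⟩
        ((w.length + 1) * (2 * (S.reg.length + w.length) + 3)) := by
    rw [hw, ← ha]
    refine Reach.mono (.head h (reach_clean _ _)) ?_
    rw [length_flat]
    nlinarith [Nat.zero_le w.length, Nat.zero_le S.reg.length,
      Nat.zero_le (w.length * S.reg.length)]
  match w with
  | [] => exact short none none _ rfl (by simp [program])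
  | [a] => exact short (some a) none _ rfl (by simp [program])
  | [a, b] => exact short (some a) (some b) _ rfl (by simp [program])
  | c₁ :: c₂ :: d :: w =>
    obtain ⟨v', ht', hb', ha', h⟩ := reach_symbol S c₁ c₂ d w v ht hb ha
    refine (h.trans (reach_run w (S.step c₁ c₂ d) v' ht' hb' ha')).mono ?_
    have := length_reg_step_le S c₁ c₂ d
    simp only [List.length_cons]
    calc _ ≤ (w.length + 1) * (2 * (S.reg.length + 1 + w.length) + 3)
        + (2 * S.reg.length + 3) := by gcongr
      _ ≤ _ := by nlinarith
  termination_by w.length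

theorem initList_machine (w : List Bool) :
    initList machine w = (⟨some .read, Vars.init, threeStacks w [] []⟩ : Config) := by
  refine congrArg (TM2.Cfg.mk _ _) (funext fun k : Fin 3 => ?_)
  match k with
  | 0 => rfl
  | 1 => rfl
  | 2 => rfl

theorem haltList_machine (w : List Bool) :
    haltList machine w = (⟨none, Vars.init, threeStacks w [] []⟩ : Config) := by
  refine congrArg (TM2.Cfg.mk _ _) (funext fun k : Fin 3 => ?_)
  match k with
  | 0 => rfl
  | 1 => rfl
  | 2 => rfl

theorem polyTimeComputable_output : PolyTimeComputable ShiftRegister.output := by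
  refine ⟨{ tm := machine, inputAlphabet := Equiv.refl Bool, outputAlphabet := Equiv.refl Bool,
            time := (.X + 1) * (2 * .X + 3), outputsFun := fun w => Classical.choice ?_ }⟩
  have h : Reach ⟨some .read, Vars.init, threeStacks w [] []⟩
      ⟨none, Vars.init, threeStacks [ShiftRegister.output w] [] []⟩
      ((w.length + 1) * (2 * (([] : List (Bool × Bool)).length + w.length) + 3)) :=
    reach_run w ⟨false, false, false, []⟩ Vars.init rfl rfl rfl
  rw [← initList_machine, ← haltList_machine] at h
  have hlen : ((.X + 1) * (2 * .X + 3) : Polynomial ℕ).eval w.length =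
      (w.length + 1) * (2 * (([] : List (Bool × Bool)).length + w.length) + 3) := by simp
  rw [id, hlen]
  exact (congrArg (fun u => Nonempty (TM2OutputsInTime machine u (some [ShiftRegister.output w])
    ((w.length + 1) * (2 * (([] : List (Bool × Bool)).length + w.length) + 3))))
    (List.map_id w)).mpr h

end ShiftRegisterMachine

/-- The bit that represents an element of `ZMod 2`. -/
def zbit (z : ZMod 2) : Bool := decide (z = 1)

/-- The element of `ZMod 2` that represents a bit. -/
def bitZ (b : Bool) : ZMod 2 := if b then 1 else 0

@[simp] theorem zbit_bitZ (b : Bool) : zbit (bitZ b) = b := by revert b; decide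
@[simp] theorem bitZ_zbit (z : ZMod 2) : bitZ (zbit z) = z := by revert z; decide
theorem zbit_add (a b : ZMod 2) : zbit (a + b) = xor (zbit a) (zbit b) := by revert a b; decide
theorem zbit_mul (a b : ZMod 2) : zbit (a * b) = (zbit a && zbit b) := by revert a b; decide
@[simp] theorem zbit_zero : zbit 0 = false := rfl

/-- The parity of a block of bits. -/
def blockParity {β : Type} [Fintype β] (y : β → Bool) : Bool := zbit (∑ i, bitZ (y i))

namespace ShiftRegister

/-- The word that is made up of the given symbols. -/
def encode (L : List (Bool × Bool × Bool)) : List Bool := L.flatMap fun c => [c.1, c.2.1, c.2.2]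

theorem run_encode (S : ShiftRegister) (L : List (Bool × Bool × Bool)) :
    S.run (encode L) = L.foldl (fun S c => S.step c.1 c.2.1 c.2.2) S := by
  induction L generalizing S with
  | nil => rfl
  | cons c L ih => exact ih _

theorem length_encode (L : List (Bool × Bool × Bool)) : (encode L).length = 3 * L.length := by
  induction L with
  | nil => rfl
  | cons c L ih =>
    change (c.1 :: c.2.1 :: c.2.2 :: encode L).length = _
    simp only [List.length_cons, ih]; omega

theorem foldl_xor_eq {β : Type} (L : List β) (y : β → Bool) (c : Bool) :
    L.foldl (fun c i => xor c (y i)) c = xor c (zbit (L.map fun i => bitZ (y i)).sum) := by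
  induction L generalizing c with
  | nil => simp
  | cons i L ih => simp [ih, zbit_add]

theorem foldl_xor_finRange {B : ℕ} (y : Fin B → Bool) (c : Bool) :
    (List.finRange B).foldl (fun c i => xor c (y i)) c = xor c (blockParity y) := by
  rw [foldl_xor_eq, blockParity, Fin.sum_univ_def]

theorem foldl_step_tap {β : Type} (L : List β) (y : β → Bool) (S : ShiftRegister) :
    L.foldl (fun S i => S.step false false (y i)) S =
      { S with tap := L.foldl (fun c i => xor c (y i)) S.tap } := by
  induction L generalizing S with
  | nil => rfl
  | cons i L ih => exact ih _

theorem foldl_step_bit {β : Type} (L : List β) (y : β → Bool) (S : ShiftRegister) :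
    L.foldl (fun S i => S.step false true (y i)) S =
      { S with bit := L.foldl (fun c i => xor c (y i)) S.bit } := by
  induction L generalizing S with
  | nil => rfl
  | cons i L ih => exact ih _

theorem shift_append_singleton (c : Bool) (l r : List (Bool × Bool)) (a s : Bool) :
    shift c (l ++ [(a, s)]) r = (s, (a, (shift c l r).1) :: (shift c l r).2) := by
  induction l generalizing c r with
  | nil => rfl
  | cons p l ih => exact ih _ _

/-- The register that holds `ℓ` consecutive bits of a sequence. -/
def window {ℓ : ℕ} (A : Fin ℓ → ZMod 2) (s : ℕ → ZMod 2) (i : ℕ) : List (Bool × Bool) :=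
  List.ofFn fun j : Fin ℓ => (zbit (A j), zbit (s (i + j)))

theorem shift_window {ℓ : ℕ} (A : Fin ℓ → ZMod 2) (s : ℕ → ZMod 2) (i : ℕ) :
    shift (zbit (s (i + ℓ))) (window A s i).reverse [] = (zbit (s i), window A s (i + 1)) := by
  induction ℓ generalizing i with
  | zero => rfl
  | succ ℓ ih =>
    have h := ih (fun j => A j.succ) (i + 1)
    have e (i : ℕ) : window A s i =
        (zbit (A 0), zbit (s i)) :: window (fun j => A j.succ) s (i + 1) := by
      simp [window, List.ofFn_succ, add_assoc, add_comm 1]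
    rw [e, List.reverse_cons, shift_append_singleton, show i + (ℓ + 1) = i + 1 + ℓ by omega, h,
      e (i + 1)]

theorem feedback_window {ℓ : ℕ} (A : Fin ℓ → ZMod 2) (s : ℕ → ZMod 2) (i : ℕ) (c : ZMod 2) :
    feedback (zbit c) (window A s i) = zbit (c + ∑ j, A j * s (i + j)) := by
  induction ℓ generalizing i c with
  | zero => simp [window, feedback]
  | succ ℓ ih =>
    have e : window A s i = (zbit (A 0), zbit (s i)) :: window (fun j => A j.succ) s (i + 1) := by
      simp [window, List.ofFn_succ, add_assoc, add_comm 1]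
    rw [e, feedback, ← zbit_mul, ← zbit_add, ih, Fin.sum_univ_succ]
    simp [add_assoc, add_comm 1]

theorem foldl_step_message {ℓ : ℕ} (A : Fin ℓ → ZMod 2) (s : ℕ → ZMod 2)
    (hs : ∀ i, s (i + ℓ) = ∑ j, A j * s (i + j)) (k : ℕ) (x : Fin k → ZMod 2) (i : ℕ)
    (S : ShiftRegister) (hS : S.reg = window A s i) :
    ((List.finRange k).foldl (fun S j => S.step true true (zbit (x j))) S).acc =
      xor S.acc (zbit (∑ j, x j * s (i + j))) := by
  induction k generalizing i S with
  | zero => simp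
  | succ k ih =>
    have hstep : S.step true true (zbit (x 0)) =
        { S with acc := xor S.acc (zbit (x 0 * s i)), reg := window A s (i + 1) } := by
      simp only [step, hS]
      rw [← zbit_zero, feedback_window, zero_add, ← hs, shift_window, zbit_mul]
    rw [List.finRange_succ, List.foldl_cons, List.foldl_map, ih (fun j => x j.succ) (i + 1),
      hstep, Fin.sum_univ_succ, zbit_add]
    · simp [add_assoc, add_comm 1]
    · rw [hstep]

/-- The symbols that load the pair number `j`; the blocks of variables are indexed by a pair number
and by whether they define the tap or the bit. -/
def loadSymbols {ℓ : ℕ} (B : ℕ) (j : Fin ℓ) :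
    List (Bool × Bool × (Bool ⊕ (Fin ℓ × Bool) × Fin B)) :=
  (List.finRange B).map (fun i => (false, false, .inr ((j, false), i))) ++
    ((List.finRange B).map (fun i => (false, true, .inr ((j, true), i))) ++
      [(true, false, .inl false)])

/-- The symbols of an input with message `x`; an address bit is the parity of a block of
variables. -/
def template {k ℓ : ℕ} (B : ℕ) (x : Fin k → ZMod 2) :
    List (Bool × Bool × (Bool ⊕ (Fin ℓ × Bool) × Fin B)) :=
  (List.finRange ℓ).reverse.flatMap (loadSymbols B) ++
    (List.finRange k).map fun i => (true, true, .inl (zbit (x i)))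

/-- Substitutes values for the variables of a template. -/
def fill {V : Type} (y : V → Bool) (c : Bool × Bool × (Bool ⊕ V)) : Bool × Bool × Bool :=
  (c.1, c.2.1, Sum.elim id y c.2.2)

theorem foldl_loadSymbols {ℓ B : ℕ} (y : (Fin ℓ × Bool) × Fin B → Bool) (j : Fin ℓ)
    (S : ShiftRegister) (h₁ : S.tap = false) (h₂ : S.bit = false) :
    ((loadSymbols B j).map (fill y)).foldl (fun S c => S.step c.1 c.2.1 c.2.2) S =
      ⟨false, false, S.acc, (blockParity fun i => y ((j, false), i),
        blockParity fun i => y ((j, true), i)) :: S.reg⟩ := by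
  simp only [loadSymbols, List.map_append, List.map_map, List.foldl_append, List.foldl_map,
    Function.comp_def, fill, Sum.elim_inr, foldl_step_tap, foldl_step_bit, foldl_xor_finRange,
    h₁, h₂, Bool.false_xor, List.map_cons, List.map_nil, List.foldl_cons, List.foldl_nil]
  rfl

theorem foldl_flatMap_loadSymbols {ℓ B : ℕ} (y : (Fin ℓ × Bool) × Fin B → Bool) (L : List (Fin ℓ))
    (S : ShiftRegister) (h₁ : S.tap = false) (h₂ : S.bit = false) :
    ((L.flatMap (loadSymbols B)).map (fill y)).foldl (fun S c => S.step c.1 c.2.1 c.2.2) S =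
      ⟨false, false, S.acc, (L.reverse.map fun j => (blockParity fun i => y ((j, false), i),
        blockParity fun i => y ((j, true), i))) ++ S.reg⟩ := by
  induction L generalizing S with
  | nil => cases S; simp_all
  | cons j L ih =>
    rw [List.flatMap_cons, List.map_append, List.foldl_append, foldl_loadSymbols y j S h₁ h₂,
      ih _ rfl rfl]
    simp

theorem output_template {k ℓ B : ℕ} (x : Fin k → ZMod 2) (A : Fin ℓ → ZMod 2) (s : ℕ → ZMod 2)
    (hs : ∀ i, s (i + ℓ) = ∑ j, A j * s (i + j)) (y : (Fin ℓ × Bool) × Fin B → Bool)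
    (hA : ∀ j, (blockParity fun i => y ((j, false), i)) = zbit (A j))
    (hy : ∀ j : Fin ℓ, (blockParity fun i => y ((j, true), i)) = zbit (s j)) :
    output (encode ((template B x).map (fill y))) = zbit (∑ j, x j * s j) := by
  rw [output, run_encode, template, List.map_append, List.foldl_append,
    foldl_flatMap_loadSymbols y _ _ rfl rfl, List.map_map, List.foldl_map]
  simp only [Function.comp_def, fill, Sum.elim_inl, id]
  rw [foldl_step_message A s hs k x 0]
  · simp
  · simp [window, hA, hy, List.ofFn_eq_map]

theorem length_template {k ℓ B : ℕ} (x : Fin k → ZMod 2) :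
    (template B x : List (Bool × Bool × (Bool ⊕ (Fin ℓ × Bool) × Fin B))).length =
      ℓ * (2 * B + 1) + k := by
  have h (L : List (Fin ℓ)) : (L.flatMap (loadSymbols B)).length = L.length * (2 * B + 1) := by
    induction L with
    | nil => simp
    | cons j L ih =>
      rw [List.flatMap_cons, List.length_append, ih]
      simp [loadSymbols]; ring
  rw [template, List.length_append, h]
  simp

end ShiftRegister

section Code

variable {K : Type} [Field K] [Algebra (ZMod 2) K]

/-- The value of the polynomial with the given coefficients. -/
def messageEval {k : ℕ} (x : Fin k → ZMod 2) (a : K) : K := ∑ i, x i • a ^ (i : ℕ)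

theorem map_mul_messageEval (φ : K →ₗ[ZMod 2] ZMod 2) {k : ℕ} (x : Fin k → ZMod 2) (a b : K) :
    φ (b * messageEval x a) = ∑ i, x i * φ (b * a ^ (i : ℕ)) := by
  simp only [messageEval, Finset.mul_sum, map_sum, mul_smul_comm, map_smul, smul_eq_mul]

theorem exists_annihilator [FiniteDimensional (ZMod 2) K] {ℓ : ℕ}
    (hℓ : Module.finrank (ZMod 2) K = ℓ) (a : K) :
    ∃ A : Fin ℓ → ZMod 2, a ^ ℓ = ∑ j, A j • a ^ (j : ℕ) := by
  set p := (Algebra.lmul (ZMod 2) K a).charpoly with hp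
  have hdeg : p.natDegree = ℓ := by rw [hp, LinearMap.charpoly_natDegree, hℓ]
  have hmonic : p.Monic := LinearMap.charpoly_monic _
  have h0 : Polynomial.aeval a p = 0 := by
    have := LinearMap.aeval_self_charpoly (Algebra.lmul (ZMod 2) K a)
    rw [← hp, Polynomial.aeval_algHom_apply] at this
    simpa using congrArg (fun f => f 1) this
  rw [Polynomial.aeval_eq_sum_range, hdeg, Finset.sum_range_succ, Finset.sum_range] at h0
  have hl : p.coeff ℓ = 1 := by rw [← hdeg]; exact hmonic
  refine ⟨fun j => -p.coeff j, ?_⟩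
  rw [hl, one_smul] at h0
  simp only [neg_smul, Finset.sum_neg_distrib]
  exact eq_neg_of_add_eq_zero_right h0

theorem boolSign_zbit_mul (a b : ZMod 2) :
    boolSign (zbit a) * boolSign (zbit b) = - boolSign (zbit (a + b)) := by
  rw [zbit_add]; cases zbit a <;> cases zbit b <;> simp [boolSign]

theorem sum_boolSign_eq_zero [Fintype K] (φ : K →ₗ[ZMod 2] ZMod 2) (hφ : φ ≠ 0) {c : K}
    (hc : c ≠ 0) : ∑ b : K, boolSign (zbit (φ (b * c))) = 0 := by
  obtain ⟨d, hd⟩ : ∃ d, φ d = 1 := by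
    by_contra! h
    refine hφ (LinearMap.ext fun d => ?_)
    have hz : ∀ z : ZMod 2, z ≠ 1 → z = 0 := by decide
    exact hz _ (h d)
  have h : ∑ b : K, boolSign (zbit (φ (b * c))) = ∑ b : K, - boolSign (zbit (φ (b * c))) := by
    refine (Fintype.sum_equiv (Equiv.addRight (d / c)) _ _ fun b => ?_).symm
    rw [Equiv.coe_addRight, add_mul, div_mul_cancel₀ _ hc, map_add, hd, zbit_add]
    cases zbit (φ (b * c)) <;> simp [boolSign, zbit]
  rw [Finset.sum_neg_distrib] at h
  linarith

theorem card_messageEval_eq_le [Fintype K] [DecidableEq K] {k : ℕ} {x x' : Fin k → ZMod 2}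
    (h : x ≠ x') :
    (Finset.univ.filter fun a : K => messageEval x a + messageEval x' a = 0).card ≤ k := by
  let p : Polynomial K := ∑ i : Fin k, Polynomial.monomial (i : ℕ) (algebraMap (ZMod 2) K (x i - x' i))
  have hcoeff (i : Fin k) : p.coeff i = algebraMap (ZMod 2) K (x i - x' i) := by
    simp only [p, Polynomial.finsetSum_coeff, Polynomial.coeff_monomial, Fin.val_inj]
    simp
  have hp : p ≠ 0 := by
    obtain ⟨i, hi⟩ := Function.ne_iff.1 h
    intro h0
    have := hcoeff i
    rw [h0, Polynomial.coeff_zero, eq_comm, map_eq_zero, sub_eq_zero] at this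
    exact hi this
  have hdeg : p.natDegree ≤ k := by
    refine Polynomial.natDegree_sum_le_of_forall_le _ _ fun i _ => ?_
    exact (Polynomial.natDegree_monomial_le _).trans i.2.le
  have heval (a : K) : p.eval a = messageEval x a - messageEval x' a := by
    simp [p, Polynomial.eval_finsetSum, messageEval, Algebra.smul_def]
  refine le_trans (Finset.card_le_card (t := p.roots.toFinset) fun a ha => ?_)
    (p.roots.toFinset_card_le.trans (p.card_roots'.trans hdeg))
  have : CharP K 2 := charP_of_injective_algebraMap (algebraMap (ZMod 2) K).injective 2
  rw [Multiset.mem_toFinset, Polynomial.mem_roots hp, Polynomial.IsRoot, heval,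
    CharTwo.sub_eq_add]
  exact (Finset.mem_filter.1 ha).2

theorem sum_mul_codeword_le [Fintype K] [DecidableEq K] (φ : K →ₗ[ZMod 2] ZMod 2) (hφ : φ ≠ 0)
    {k : ℕ} {x x' : Fin k → ZMod 2} (h : x ≠ x') :
    |∑ ab : K × K, boolSign (zbit (φ (ab.2 * messageEval x ab.1))) *
      boolSign (zbit (φ (ab.2 * messageEval x' ab.1)))| ≤ k * Fintype.card K := by
  have hinner (a : K) : |∑ b : K, boolSign (zbit (φ (b * messageEval x a))) *
      boolSign (zbit (φ (b * messageEval x' a)))| ≤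
      if messageEval x a + messageEval x' a = 0 then (Fintype.card K : ℝ) else 0 := by
    simp only [boolSign_zbit_mul, ← map_add, ← mul_add, Finset.sum_neg_distrib, abs_neg]
    split_ifs with h0
    · refine (Finset.abs_sum_le_sum_abs _ _).trans ?_
      simp [h0, boolSign]
    · rw [sum_boolSign_eq_zero φ hφ h0, abs_zero]
  rw [Fintype.sum_prod_type]
  refine (Finset.abs_sum_le_sum_abs _ _).trans ((Finset.sum_le_sum fun a _ => hinner a).trans ?_)
  rw [← Finset.sum_filter, Finset.sum_const, nsmul_eq_mul]
  gcongr
  exact card_messageEval_eq_le h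

end Code

open ShiftRegister in
/-- The codewords are computed by the register from address bits that are blockwise parities, and
they are nearly orthogonal to each other under a suitable distribution of addresses. -/
theorem exists_code (k ℓ : ℕ) (hℓ : ℓ ≠ 0) :
    ∃ (Ω : Type) (_ : Fintype Ω) (address : Ω → Fin ℓ × Bool → Bool)
      (F : (Fin k → ZMod 2) → Ω → Bool), Fintype.card Ω = 2 ^ ℓ * 2 ^ ℓ ∧
      (∀ x x', x ≠ x' → |∑ ω, boolSign (F x ω) * boolSign (F x' ω)| ≤ k * 2 ^ ℓ) ∧
      ∀ (B : ℕ) (x : Fin k → ZMod 2) (ω : Ω) (y : (Fin ℓ × Bool) × Fin B → Bool),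
        (∀ v, (blockParity fun i => y (v, i)) = address ω v) →
          output (encode ((template B x).map (fill y))) = F x ω := by
  classical
  let K := GaloisField 2 ℓ
  let _ : Fintype K := Fintype.ofFinite K
  have hcard : Fintype.card K = 2 ^ ℓ := by
    rw [← Nat.card_eq_fintype_card]; exact GaloisField.card 2 ℓ hℓ
  obtain ⟨φ, hφ⟩ : ∃ φ : K →ₗ[ZMod 2] ZMod 2, φ ≠ 0 := by
    obtain ⟨φ, hφ⟩ := Module.Projective.exists_dual_ne_zero (ZMod 2) (one_ne_zero (α := K))
    exact ⟨φ, fun h => hφ (by rw [h, LinearMap.zero_apply])⟩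
  choose A hA using exists_annihilator (K := K) (GaloisField.finrank 2 hℓ)
  refine ⟨K × K, inferInstance, fun ab v =>
    if v.2 then zbit (φ (ab.2 * ab.1 ^ (v.1 : ℕ))) else zbit (A ab.1 v.1),
    fun x ab => zbit (φ (ab.2 * messageEval x ab.1)), by rw [Fintype.card_prod, hcard],
    fun x x' h => ?_, fun B x ab y h => ?_⟩
  · have := sum_mul_codeword_le φ hφ h
    rwa [hcard, Nat.cast_pow, Nat.cast_ofNat] at this
  · have hs (i : ℕ) : φ (ab.2 * ab.1 ^ (i + ℓ)) =
        ∑ j, A ab.1 j * φ (ab.2 * ab.1 ^ (i + (j : ℕ))) := by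
      rw [pow_add, hA ab.1, Finset.mul_sum, Finset.mul_sum, map_sum]
      refine Finset.sum_congr rfl fun j _ => ?_
      rw [mul_smul_comm, mul_smul_comm, map_smul, smul_eq_mul, pow_add]
    rw [output_template x (A ab.1) (fun i => φ (ab.2 * ab.1 ^ i)) hs y
      (fun j => by simp [h]) (fun j => by simp [h])]
    exact congrArg zbit (map_mul_messageEval φ x ab.1 ab.2).symm

theorem boolSign_sq (b : Bool) : boolSign b ^ 2 = 1 := by cases b <;> simp [boolSign]

theorem abs_boolSign (b : Bool) : |boolSign b| = 1 := by cases b <;> simp [boolSign]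

/-- Few members of a nearly orthogonal family of sign vectors correlate with a given sign vector. -/
theorem card_correlated_le {ι Ω : Type} [Fintype Ω] [Nonempty Ω] (S : Finset ι) (F : ι → Ω → Bool)
    (g : Ω → Bool) {κ δ : ℝ} (hδ : 0 ≤ δ) (hκ : 0 ≤ κ)
    (horth : ∀ i ∈ S, ∀ j ∈ S, i ≠ j →
      |∑ ω, boolSign (F i ω) * boolSign (F j ω)| ≤ κ * Fintype.card Ω)
    (hcorr : ∀ i ∈ S, δ * Fintype.card Ω ≤ |∑ ω, boolSign (F i ω) * boolSign (g ω)|) :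
    S.card * (δ ^ 2 - κ) ≤ 1 := by
  classical
  set N : ℝ := ((Fintype.card Ω : ℕ) : ℝ) with hN
  have hN0 : 0 < N := by rw [hN]; exact_mod_cast Fintype.card_pos
  rcases S.eq_empty_or_nonempty with rfl | hS
  · simp
  have hS0 : (0 : ℝ) < S.card := by exact_mod_cast hS.card_pos
  choose e he using fun i : ι => show ∃ e : ℝ, |e| = 1 ∧
      e * ∑ ω, boolSign (F i ω) * boolSign (g ω) = |∑ ω, boolSign (F i ω) * boolSign (g ω)| by
    rcases abs_cases (∑ ω, boolSign (F i ω) * boolSign (g ω)) with h | h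
    · exact ⟨1, by simp, by rw [h.1, one_mul]⟩
    · exact ⟨-1, by simp, by rw [h.1]; ring⟩
  let G : Ω → ℝ := fun ω => ∑ i ∈ S, e i * boolSign (F i ω)
  have hlow : S.card * (δ * N) ≤ ∑ ω, G ω * boolSign (g ω) := by
    calc S.card * (δ * N) = ∑ i ∈ S, δ * N := by simp
      _ ≤ ∑ i ∈ S, e i * ∑ ω, boolSign (F i ω) * boolSign (g ω) :=
        Finset.sum_le_sum fun i hi => by rw [(he i).2]; exact hcorr i hi
      _ = ∑ ω, G ω * boolSign (g ω) := by
        simp only [G, Finset.mul_sum, Finset.sum_mul]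
        rw [Finset.sum_comm]
        simp only [mul_assoc]
  have hG : ∑ ω, G ω ^ 2 ≤ S.card * N + S.card * (S.card * (κ * N)) := by
    calc ∑ ω, G ω ^ 2 = ∑ i ∈ S, ∑ j ∈ S, e i * e j * ∑ ω, boolSign (F i ω) * boolSign (F j ω) := by
          simp_rw [G, sq, Finset.sum_mul_sum]
          rw [Finset.sum_comm]
          refine Finset.sum_congr rfl fun i _ => ?_
          rw [Finset.sum_comm]
          refine Finset.sum_congr rfl fun j _ => ?_
          rw [Finset.mul_sum]
          exact Finset.sum_congr rfl fun ω _ => by ring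
      _ ≤ ∑ i ∈ S, ∑ j ∈ S, ((if i = j then N else 0) + κ * N) := by
          refine Finset.sum_le_sum fun i hi => Finset.sum_le_sum fun j hj => ?_
          refine (le_abs_self _).trans ?_
          rw [abs_mul, abs_mul, (he i).1, (he j).1, one_mul, one_mul]
          split_ifs with hij
          · subst hij
            simp only [← sq, boolSign_sq]
            rw [Finset.sum_const, Finset.card_univ, nsmul_eq_mul, mul_one, ← hN,
              abs_of_pos hN0]
            nlinarith [mul_nonneg hκ hN0.le]
          · rw [zero_add]; exact horth i hi j hj hij
      _ = _ := by simp [Finset.sum_add_distrib]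
  have hcs := Finset.sum_mul_sq_le_sq_mul_sq Finset.univ G (fun ω => boolSign (g ω))
  have hg : ∑ ω, boolSign (g ω) ^ 2 = N := by simp [boolSign_sq, hN]
  rw [hg] at hcs
  have h1 : (S.card * (δ * N)) ^ 2 ≤ (S.card * N + S.card * (S.card * (κ * N))) * N :=
    (pow_le_pow_left₀ (by positivity) hlow 2).trans
      (hcs.trans (mul_le_mul_of_nonneg_right hG hN0.le))
  have h2 : (S.card * N ^ 2) * (S.card * (δ ^ 2 - κ)) ≤ (S.card * N ^ 2) * 1 := by nlinarith
  exact le_of_mul_le_mul_left h2 (by positivity)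

/-- The discriminator lemma: an unweighted majority gate correlates with one of its inputs or is
biased. -/
theorem ThresholdGate.IsUnweightedMajority.exists_correlated {ι Ω : Type} [Fintype Ω] [Nonempty Ω]
    {φ : ThresholdGate ι} (hφ : φ.IsUnweightedMajority) (g : ι → Ω → Bool) :
    ∃ h : Ω → Bool, ((∃ i, h = g i) ∨ h = fun _ => true) ∧
      1 / (4 * (φ.fanIn + 1)) * (Fintype.card Ω : ℝ) ≤
        |∑ ω, boolSign (φ.eval fun i => g i ω) * boolSign (h ω)| := by
  classical
  by_contra! hlt
  set N : ℝ := ((Fintype.card Ω : ℕ) : ℝ) with hN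
  have hN0 : 0 < N := by rw [hN]; exact_mod_cast Fintype.card_pos
  set m : ℝ := (φ.fanIn : ℝ) with hm
  have hm0 : 0 ≤ m := by rw [hm]; positivity
  set c : ℝ := 1 / (4 * (m + 1)) * N with hc
  have hc0 : 0 < c := by positivity
  let s : Ω → ℝ := fun ω => boolSign (φ.eval fun i => g i ω)
  let T : Ω → ℝ := fun ω => ∑ i ∈ φ.inputs, φ.weight i * boolSign (g i ω)
  have hT (ω : Ω) : ∃ τ : ℤ, T ω = τ := by
    refine ⟨∑ i ∈ φ.inputs, (if φ.weight i = 1 then 1 else -1) * (if g i ω then 1 else -1), ?_⟩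
    push_cast
    refine Finset.sum_congr rfl fun i hi => ?_
    congr 1
    split_ifs with h
    · exact h
    · exact (eq_or_eq_neg_of_abs_eq (hφ i hi)).resolve_left h
  have hTm (ω : Ω) : |T ω| ≤ m := by
    refine (Finset.abs_sum_le_sum_abs _ _).trans ?_
    rw [Finset.sum_congr rfl fun i hi => by rw [abs_mul, hφ i hi, abs_boolSign]]
    simp [hm, ThresholdGate.fanIn]
  let u : ℤ := max (-(φ.fanIn + 1)) (min φ.fanIn ⌊φ.threshold⌋)
  have hu : |(u : ℝ) + 1 / 2| ≤ m + 1 / 2 := by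
    have h1 : -((φ.fanIn : ℤ) + 1) ≤ u := le_max_left _ _
    have h2 : u ≤ φ.fanIn := max_le (by omega) (min_le_left _ _)
    have h1' : -(m + 1) ≤ (u : ℝ) := by rw [hm]; exact_mod_cast h1
    have h2' : (u : ℝ) ≤ m := by rw [hm]; exact_mod_cast h2
    rw [abs_le]; constructor <;> linarith
  have hmargin (ω : Ω) : 1 / 2 ≤ s ω * (T ω - (u + 1 / 2)) := by
    obtain ⟨τ, hτ⟩ := hT ω
    have hb := abs_le.1 (hTm ω)
    rw [hτ, hm] at hb
    have hb1 : -(φ.fanIn : ℤ) ≤ τ := by exact_mod_cast hb.1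
    have hb2 : τ ≤ φ.fanIn := by exact_mod_cast hb.2
    have hev : (φ.eval fun i => g i ω) = decide (⌊φ.threshold⌋ < τ) := by
      have : φ.eval (fun i => g i ω) = decide (0 < T ω - φ.threshold) := by
        simp only [ThresholdGate.eval, T]
      rw [this, hτ]
      simp only [sub_pos, Int.floor_lt]
    have hiff : ⌊φ.threshold⌋ < τ ↔ u < τ := by omega
    simp only [s, hev, hτ, hiff, boolSign, decide_eq_true_eq]
    split_ifs with h
    · have : (u : ℝ) + 1 ≤ τ := by exact_mod_cast h
      linarith
    · have : (τ : ℝ) ≤ u := by exact_mod_cast not_lt.1 h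
      linarith
  have hsum : N * (1 / 2) ≤ ∑ ω, s ω * (T ω - (u + 1 / 2)) := by
    refine le_trans (le_of_eq ?_) (Finset.sum_le_sum fun ω _ => hmargin ω)
    simp [hN]
  have hsplit : ∑ ω, s ω * (T ω - (u + 1 / 2)) =
      ∑ i ∈ φ.inputs, φ.weight i * ∑ ω, s ω * boolSign (g i ω) -
        (u + 1 / 2) * ∑ ω, s ω * boolSign true := by
    simp only [mul_sub, Finset.sum_sub_distrib, T, Finset.mul_sum, boolSign, if_true, mul_one]
    rw [Finset.sum_comm]
    congr 1
    · exact Finset.sum_congr rfl fun i _ => Finset.sum_congr rfl fun ω _ => by ring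
    · exact Finset.sum_congr rfl fun ω _ => by ring
  have hA : ∑ i ∈ φ.inputs, φ.weight i * ∑ ω, s ω * boolSign (g i ω) ≤ m * c := by
    refine (Finset.sum_le_card_nsmul _ _ c fun i hi => ?_).trans (by simp [hm, ThresholdGate.fanIn])
    refine (le_abs_self _).trans ?_
    rw [abs_mul, hφ i hi, one_mul]
    exact (hlt _ (.inl ⟨i, rfl⟩)).le
  have hB : -((u + 1 / 2) * ∑ ω, s ω * boolSign true) ≤ (m + 1 / 2) * c := by
    refine (neg_le_abs _).trans ?_
    rw [abs_mul]
    exact mul_le_mul hu (hlt _ (.inr rfl)).le (abs_nonneg _) (by positivity)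
  have hcm : 4 * (m + 1) * c = N := by rw [hc]; field_simp
  nlinarith

theorem sum_choose_le_pow (n D : ℕ) : ∑ i ∈ Finset.range (D + 1), n.choose i ≤ (n + 1) ^ D := by
  induction D with
  | zero => simp
  | succ D ih =>
    rw [Finset.sum_range_succ, pow_succ, mul_add, mul_one, add_comm]
    refine add_le_add ((Nat.choose_le_pow n (D + 1)).trans ?_) ih
    rw [pow_succ]
    gcongr
    omega

section SignPatterns

variable {Z : Type} [Fintype Z] [DecidableEq Z]

theorem Finset.Shatters.card_le_finrank {V : Submodule ℝ (Z → ℝ)} {𝒜 : Finset (Finset Z)}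
    (h𝒜 : ∀ A ∈ 𝒜, ∃ F ∈ V, ∀ z, z ∈ A ↔ 0 < F z) {S : Finset Z} (hS : 𝒜.Shatters S) :
    S.card ≤ Module.finrank ℝ V := by
  by_contra! hlt
  let R : V →ₗ[ℝ] (S → ℝ) := (LinearMap.funLeft ℝ ℝ (Subtype.val : S → Z)) ∘ₗ V.subtype
  have hR : LinearMap.range R < ⊤ := by
    refine lt_top_iff_ne_top.2 fun h => ?_
    have h1 := LinearMap.finrank_range_le R
    rw [h, finrank_top, Module.finrank_fintype_fun_eq_card, Fintype.card_coe] at h1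
    omega
  obtain ⟨f, hf0, hf⟩ : ∃ f : (S → ℝ) →ₗ[ℝ] ℝ, (∃ s, 0 < f (fun j => if s = j then 1 else 0)) ∧
      ∀ F ∈ V, f (fun s => F s) = 0 := by
    obtain ⟨f, hf0, hf⟩ := Submodule.exists_le_ker_of_lt_top _ hR
    have hz (F : Z → ℝ) (hF : F ∈ V) : f (fun s => F s) = 0 := hf ⟨⟨F, hF⟩, rfl⟩
    obtain ⟨s, hs⟩ : ∃ s, f (fun j => if s = j then 1 else 0) ≠ 0 := by
      by_contra! h
      refine hf0 (LinearMap.ext fun v => ?_)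
      rw [LinearMap.pi_apply_eq_sum_univ]
      refine Finset.sum_eq_zero fun s _ => ?_
      rw [h s, smul_zero]
    rcases lt_or_gt_of_ne hs with h | h
    · exact ⟨-f, ⟨s, by simpa using h⟩, fun F hF => by simp [hz F hF]⟩
    · exact ⟨f, ⟨s, h⟩, hz⟩
  obtain ⟨A, hA, hSA⟩ := hS (t := S.filter fun z => ∃ h : z ∈ S, 0 < f (fun j => if ⟨z, h⟩ = j then 1 else 0))
    (Finset.filter_subset _ _)
  obtain ⟨F, hF, hFA⟩ := h𝒜 A hA
  have hiff (s : S) : 0 < F s ↔ 0 < f (fun j => if s = j then 1 else 0) := by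
    have := Finset.ext_iff.1 hSA s
    simp only [Finset.mem_inter, s.2, true_and, Finset.mem_filter, exists_true_left, hFA] at this
    exact this
  have h0 := hf F hF
  rw [LinearMap.pi_apply_eq_sum_univ] at h0
  obtain ⟨s, hs⟩ := hf0
  refine h0.not_gt (Finset.sum_pos' (fun s _ => ?_)
    ⟨s, Finset.mem_univ _, mul_pos ((hiff s).2 hs) hs⟩)
  by_cases h : 0 < F s
  · exact (mul_pos h ((hiff s).1 h)).le
  · exact mul_nonneg_of_nonpos_of_nonpos (not_lt.1 h) (not_lt.1 (mt (hiff s).2 h))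

/-- A bound for the number of sign patterns of the functions in a vector space. -/
theorem card_signPatterns_le (V : Submodule ℝ (Z → ℝ)) {D : ℕ} (hD : Module.finrank ℝ V ≤ D)
    (𝒢 : Finset (Z → Bool)) (h𝒢 : ∀ g ∈ 𝒢, ∃ F ∈ V, ∀ z, g z = decide (0 < F z)) :
    𝒢.card ≤ (Fintype.card Z + 1) ^ D := by
  let e : (Z → Bool) → Finset Z := fun g => Finset.univ.filter fun z => g z = true
  have he : Function.Injective e := fun g g' h => by
    funext z
    have := Finset.ext_iff.1 h z
    simp only [e, Finset.mem_filter, Finset.mem_univ, true_and] at this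
    exact Bool.eq_iff_iff.2 this
  have hS (S : Finset Z) (hS : (𝒢.image e).Shatters S) : S.card ≤ D := by
    refine (hS.card_le_finrank fun A hA => ?_).trans hD
    obtain ⟨g, hg, rfl⟩ := Finset.mem_image.1 hA
    obtain ⟨F, hF, h⟩ := h𝒢 g hg
    exact ⟨F, hF, fun z => by simp [e, h]⟩
  rw [← Finset.card_image_of_injective 𝒢 he]
  refine (Finset.card_le_card_shatterer _).trans ((Finset.card_shatterer_le_sum_vcDim).trans ?_)
  refine le_trans (Finset.sum_le_sum_of_subset fun i hi => ?_) (sum_choose_le_pow _ D)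
  rw [Finset.mem_range, Nat.lt_succ_iff]
  exact (Finset.mem_Iic.1 hi).trans (Finset.sup_le fun S h => hS S (Finset.mem_shatterer.1 h))

end SignPatterns

section Influence

variable {β : Type} [DecidableEq β]

/-- Flips the value at `i`. -/
def flipAt (i : β) : Equiv.Perm (β → Bool) :=
  Function.Involutive.toPerm (fun x => Function.update x i (!x i)) fun x => by simp

@[simp] theorem flipAt_same (i : β) (x : β → Bool) : flipAt i x i = !x i :=
  Function.update_self ..

theorem flipAt_ne {i j : β} (h : j ≠ i) (x : β → Bool) : flipAt i x j = x j :=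
  Function.update_of_ne h _ _

variable [Fintype β]

theorem boolSign_not (b : Bool) : boolSign (!b) = - boolSign b := by cases b <;> simp [boolSign]

theorem sum_boolSign_mul_boolSign (i j : β) :
    ∑ x : β → Bool, boolSign (x i) * boolSign (x j) = if i = j then 2 ^ Fintype.card β else 0 := by
  split_ifs with h
  · subst h
    simp [← sq, boolSign_sq]
  · have := Equiv.sum_comp (flipAt i) fun x : β → Bool => boolSign (x i) * boolSign (x j)
    simp only [flipAt_same, flipAt_ne (Ne.symm h), boolSign_not, neg_mul,
      Finset.sum_neg_distrib] at this
    linarith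

/-- The variable `i` is pivotal for the threshold function `0 < K + ⟨a, x⟩`. -/
def Pivotal (K : ℝ) (a : β → ℝ) (i : β) (x : β → Bool) : Prop :=
  K + ∑ j ∈ Finset.univ.erase i, a j * boolSign (x j) - |a i| ≤ 0 ∧
    0 < K + ∑ j ∈ Finset.univ.erase i, a j * boolSign (x j) + |a i|

theorem sign_add_sign_eq (R r : ℝ) (b : Bool) :
    (if 0 < R + r * boolSign b then (1 : ℝ) else -1) * ((if 0 ≤ r then 1 else -1) * boolSign b) +
      (if 0 < R - r * boolSign b then 1 else -1) * ((if 0 ≤ r then 1 else -1) * boolSign !b) =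
        if R - |r| ≤ 0 ∧ 0 < R + |r| then 2 else 0 := by
  rcases le_or_gt 0 r with h | h
  · rw [abs_of_nonneg h, if_pos h]
    cases b <;> simp only [boolSign, Bool.not_true, Bool.not_false, if_true, if_false,
      Bool.false_eq_true] <;> grind
  · rw [abs_of_neg h, if_neg h.not_ge]
    cases b <;> simp only [boolSign, Bool.not_true, Bool.not_false, if_true, if_false,
      Bool.false_eq_true] <;> grind

open Classical in
/-- The total influence of a threshold function of `B` variables is at most `√B`. -/
theorem sum_card_pivotal_le (K : ℝ) (a : β → ℝ) :
    ∑ i, ((Finset.univ.filter fun x => Pivotal K a i x).card : ℝ) ≤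
      √(Fintype.card β) * 2 ^ Fintype.card β := by
  let f : (β → Bool) → ℝ := fun x => if 0 < K + ∑ j, a j * boolSign (x j) then 1 else -1
  let σ : β → ℝ := fun i => if 0 ≤ a i then 1 else -1
  have hσ (i : β) : σ i * σ i = 1 := by simp only [σ]; split_ifs <;> norm_num
  have hpiv (i : β) : ((Finset.univ.filter fun x => Pivotal K a i x).card : ℝ) =
      ∑ x, f x * (σ i * boolSign (x i)) := by
    have h2 : ∑ x, f x * (σ i * boolSign (x i)) =
        ∑ x, f (flipAt i x) * (σ i * boolSign (flipAt i x i)) :=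
      (Equiv.sum_comp (flipAt i) fun x : β → Bool => f x * (σ i * boolSign (x i))).symm
    have h3 : (2 : ℝ) * ((Finset.univ.filter fun x => Pivotal K a i x).card : ℝ) =
        ∑ x, f x * (σ i * boolSign (x i)) +
          ∑ x, f (flipAt i x) * (σ i * boolSign (flipAt i x i)) := by
      rw [← Finset.sum_add_distrib, Finset.card_filter, Nat.cast_sum, Finset.mul_sum]
      refine Finset.sum_congr rfl fun x _ => ?_
      have e1 : K + ∑ j, a j * boolSign (x j) =
          K + ∑ j ∈ Finset.univ.erase i, a j * boolSign (x j) + a i * boolSign (x i) := by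
        rw [← Finset.sum_erase_add _ _ (Finset.mem_univ i), add_assoc]
      have e2 : K + ∑ j, a j * boolSign (flipAt i x j) =
          K + ∑ j ∈ Finset.univ.erase i, a j * boolSign (x j) - a i * boolSign (x i) := by
        rw [← Finset.sum_erase_add _ _ (Finset.mem_univ i), flipAt_same, boolSign_not,
          Finset.sum_congr rfl fun j hj => by rw [flipAt_ne (Finset.ne_of_mem_erase hj)]]
        ring
      simp only [f, e1, e2, flipAt_same, σ]
      rw [sign_add_sign_eq]
      by_cases hp : Pivotal K a i x
      · rw [if_pos hp]; unfold Pivotal at hp; rw [if_pos hp]; norm_num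
      · rw [if_neg hp]; unfold Pivotal at hp; rw [if_neg hp]; norm_num
    linarith
  simp only [hpiv]
  rw [Finset.sum_comm]
  simp only [← Finset.mul_sum]
  have hcs := Finset.sum_mul_sq_le_sq_mul_sq Finset.univ f fun x => ∑ i, σ i * boolSign (x i)
  have hf : ∑ x, f x ^ 2 = 2 ^ Fintype.card β := by
    have : ∀ x, f x ^ 2 = 1 := fun x => by simp only [f]; split_ifs <;> norm_num
    simp [this]
  have hg : ∑ x : β → Bool, (∑ i, σ i * boolSign (x i)) ^ 2 =
      Fintype.card β * 2 ^ Fintype.card β := by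
    calc _ = ∑ i, ∑ j, σ i * σ j * ∑ x : β → Bool, boolSign (x i) * boolSign (x j) := by
          simp_rw [sq, Finset.sum_mul_sum]
          rw [Finset.sum_comm]
          refine Finset.sum_congr rfl fun i _ => ?_
          rw [Finset.sum_comm]
          refine Finset.sum_congr rfl fun j _ => ?_
          rw [Finset.mul_sum]
          exact Finset.sum_congr rfl fun ω _ => by ring
      _ = _ := by simp [sum_boolSign_mul_boolSign, hσ]
  rw [hf, hg] at hcs
  refine (le_abs_self _).trans (abs_le_of_sq_le_sq ?_ (by positivity))
  rw [mul_pow, Real.sq_sqrt (by positivity)]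
  linarith

end Influence

section Restriction

variable {T β : Type} [Fintype T] [DecidableEq T] [Fintype β] [DecidableEq β]

theorem sum_sum_update {Q : Type} [Fintype Q] (b : T) (f : (T → Q) → ℝ) :
    ∑ ρ, ∑ q, f (Function.update ρ b q) = Fintype.card Q * ∑ ρ, f ρ := by
  let e : Equiv.Perm ((T → Q) × Q) :=
    Function.Involutive.toPerm (fun p => (Function.update p.1 b p.2, p.1 b)) fun p => by simp
  have h := Equiv.sum_comp e fun p => f p.1
  rw [Fintype.sum_prod_type, Fintype.sum_prod_type] at h
  change ∑ ρ, ∑ q, f (Function.update ρ b q) = ∑ ρ, ∑ _q : Q, f ρ at h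
  simp only [h, Finset.sum_const, Finset.card_univ, nsmul_eq_mul, Finset.mul_sum]

/-- The variables form blocks indexed by `T`. A restriction chooses for each block a position, whose
variable stays free, and values for the block. This is the contribution of the fixed variables of a
block to a linear form. -/
def fixedPart (a : β → ℝ) (q : β × (β → Bool)) : ℝ :=
  ∑ i ∈ Finset.univ.erase q.1, a i * boolSign (q.2 i)

/-- An affine form after a restriction, as a function of the free variables. -/
def restrictedForm (c : ℝ) (a : T → β → ℝ) (ρ : T → β × (β → Bool)) (z : T → Bool) : ℝ :=
  c + ∑ b, (fixedPart (a b) (ρ b) + a b (ρ b).1 * boolSign (z b))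

/-- The sign of the affine form is not constant after the restriction. -/
def Survives (c : ℝ) (a : T → β → ℝ) (ρ : T → β × (β → Bool)) : Prop :=
  ∃ z z', 0 < restrictedForm c a ρ z ∧ restrictedForm c a ρ z' ≤ 0

/-- The value of the restricted form where the free variables of the blocks in `S` increase it and
the others decrease it. -/
def extremeForm (c : ℝ) (a : T → β → ℝ) (ρ : T → β × (β → Bool)) (S : Finset T) : ℝ :=
  c + ∑ b, (fixedPart (a b) (ρ b) + if b ∈ S then |a b (ρ b).1| else -|a b (ρ b).1|)

theorem abs_mul_boolSign (r : ℝ) (b : Bool) : |r * boolSign b| = |r| := by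
  rw [abs_mul, abs_boolSign, mul_one]

theorem Survives.exists_extremeForm {c : ℝ} {a : T → β → ℝ} {ρ : T → β × (β → Bool)}
    (h : Survives c a ρ) (e : T ≃ Fin (Fintype.card T)) :
    ∃ b, extremeForm c a ρ (Finset.univ.filter fun b' => e b' < e b) ≤ 0 ∧
      0 < extremeForm c a ρ (insert b (Finset.univ.filter fun b' => e b' < e b)) := by
  obtain ⟨z, z', hz, hz'⟩ := h
  let W : ℕ → ℝ := fun m => extremeForm c a ρ (Finset.univ.filter fun b' => (e b' : ℕ) < m)
  have h0 : W 0 ≤ 0 := by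
    refine le_trans ?_ hz'
    simp only [W, extremeForm, restrictedForm]
    gcongr with b
    simp only [Nat.not_lt_zero, Finset.filter_false, Finset.notMem_empty, if_false]
    rw [← abs_mul_boolSign _ (z' b)]
    exact neg_abs_le _
  have hT : 0 < W (Fintype.card T) := by
    refine lt_of_lt_of_le hz ?_
    simp only [W, extremeForm, restrictedForm]
    gcongr with b
    simp only [Finset.mem_filter, Finset.mem_univ, true_and, Fin.is_lt, if_true]
    rw [← abs_mul_boolSign _ (z b)]
    exact le_abs_self _
  obtain ⟨m, hm, hm1, hm2⟩ : ∃ m < Fintype.card T, W m ≤ 0 ∧ 0 < W (m + 1) := by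
    by_contra! hcon
    have : ∀ m ≤ Fintype.card T, W m ≤ 0 := by
      intro m
      induction m with
      | zero => exact fun _ => h0
      | succ m ih => exact fun hm => hcon m hm (ih (by omega))
    exact (this _ le_rfl).not_gt hT
  refine ⟨e.symm ⟨m, hm⟩, ?_, ?_⟩
  · convert! hm1 using 3
    simp [Fin.lt_def]
  · convert! hm2 using 2
    ext b
    simp only [Finset.mem_insert, Finset.mem_filter, Finset.mem_univ, true_and, Fin.lt_def,
      Equiv.apply_symm_apply, Equiv.eq_symm_apply, Fin.ext_iff]
    omega

open Classical in
theorem card_extremeForm_le (c : ℝ) (a : T → β → ℝ) (b : T) (S : Finset T) (hb : b ∉ S) :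
    Fintype.card β * ((Finset.univ.filter fun ρ : T → β × (β → Bool) =>
      extremeForm c a ρ S ≤ 0 ∧ 0 < extremeForm c a ρ (insert b S)).card : ℝ) ≤
      √(Fintype.card β) * Fintype.card (T → β × (β → Bool)) := by
  have hQ : (Fintype.card (β × (β → Bool)) : ℝ) = Fintype.card β * 2 ^ Fintype.card β := by
    simp
  have key (ρ : T → β × (β → Bool)) : ∑ q, (if extremeForm c a (Function.update ρ b q) S ≤ 0 ∧
      0 < extremeForm c a (Function.update ρ b q) (insert b S) then (1 : ℝ) else 0) ≤
      √(Fintype.card β) * 2 ^ Fintype.card β := by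
    let K : ℝ := c + ∑ b' ∈ Finset.univ.erase b, (fixedPart (a b') (ρ b') +
      if b' ∈ S then |a b' (ρ b').1| else -|a b' (ρ b').1|)
    have h1 (q : β × (β → Bool)) : extremeForm c a (Function.update ρ b q) S =
        K + fixedPart (a b) q - |a b q.1| := by
      rw [extremeForm, ← Finset.sum_erase_add _ _ (Finset.mem_univ b)]
      simp only [Function.update_self, if_neg hb, K]
      rw [Finset.sum_congr rfl fun b' hb' => by
        rw [Function.update_of_ne (Finset.ne_of_mem_erase hb')]]
      ring
    have h2 (q : β × (β → Bool)) : extremeForm c a (Function.update ρ b q) (insert b S) =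
        K + fixedPart (a b) q + |a b q.1| := by
      rw [extremeForm, ← Finset.sum_erase_add _ _ (Finset.mem_univ b)]
      rw [Finset.sum_congr rfl fun b' hb' => show _ = fixedPart (a b') (ρ b') +
        if b' ∈ S then |a b' (ρ b').1| else -|a b' (ρ b').1| by
          simp [Finset.ne_of_mem_erase hb']]
      simp only [Function.update_self, Finset.mem_insert, true_or, if_true, K]
      ring
    simp only [h1, h2]
    refine le_trans (le_of_eq ?_) (sum_card_pivotal_le K (a b))
    rw [Fintype.sum_prod_type]
    refine Finset.sum_congr rfl fun i _ => ?_
    rw [Finset.card_filter, Nat.cast_sum]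
    refine Finset.sum_congr rfl fun x _ => ?_
    rw [Nat.cast_ite, Nat.cast_one, Nat.cast_zero]
    exact if_congr Iff.rfl rfl rfl
  have hsum := (sum_sum_update b fun ρ : T → β × (β → Bool) => if extremeForm c a ρ S ≤ 0 ∧
    0 < extremeForm c a ρ (insert b S) then (1 : ℝ) else 0).symm.trans_le
    (Finset.sum_le_sum fun ρ _ => key ρ)
  rw [Finset.sum_const, Finset.card_univ, nsmul_eq_mul, hQ] at hsum
  rw [Finset.card_filter, Nat.cast_sum]
  simp only [Nat.cast_ite, Nat.cast_one, Nat.cast_zero]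
  refine le_of_mul_le_mul_left (a := (2 : ℝ) ^ Fintype.card β) ?_ (by positivity)
  linarith

open Classical in
/-- A threshold function rarely survives a random restriction. -/
theorem card_survives_le (c : ℝ) (a : T → β → ℝ) :
    Fintype.card β * ((Finset.univ.filter fun ρ : T → β × (β → Bool) => Survives c a ρ).card : ℝ) ≤
      Fintype.card T * √(Fintype.card β) * Fintype.card (T → β × (β → Bool)) := by
  let e := Fintype.equivFin T
  let E : T → Finset (T → β × (β → Bool)) := fun b => Finset.univ.filter fun ρ =>
    extremeForm c a ρ (Finset.univ.filter fun b' => e b' < e b) ≤ 0 ∧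
      0 < extremeForm c a ρ (insert b (Finset.univ.filter fun b' => e b' < e b))
  have hsub : (Finset.univ.filter fun ρ : T → β × (β → Bool) => Survives c a ρ) ⊆
      Finset.univ.biUnion E := fun ρ hρ => by
    obtain ⟨b, hb⟩ := (Finset.mem_filter.1 hρ).2.exists_extremeForm e
    exact Finset.mem_biUnion.2 ⟨b, Finset.mem_univ _, Finset.mem_filter.2 ⟨Finset.mem_univ _, hb⟩⟩
  have hcard : ((Finset.univ.filter fun ρ : T → β × (β → Bool) => Survives c a ρ).card : ℝ) ≤
      ∑ b, ((E b).card : ℝ) := by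
    exact_mod_cast (Finset.card_le_card hsub).trans Finset.card_biUnion_le
  calc _ ≤ Fintype.card β * ∑ b, ((E b).card : ℝ) := by gcongr
    _ = ∑ b, Fintype.card β * ((E b).card : ℝ) := Finset.mul_sum _ _ _
    _ ≤ ∑ b : T, √(Fintype.card β) * Fintype.card (T → β × (β → Bool)) :=
      Finset.sum_le_sum fun b _ => card_extremeForm_le c a b _ (by simp)
    _ = _ := by rw [Finset.sum_const, Finset.card_univ, nsmul_eq_mul, mul_assoc]

/-- The number of wires in `P` that stay free. -/
def liveCount (P : Finset (T × β)) (ρ : T → β × (β → Bool)) : ℕ :=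
  (Finset.univ.filter fun b => (b, (ρ b).1) ∈ P).card

theorem sum_comp_fst (h : β → ℝ) :
    ∑ q : β × (β → Bool), h q.1 = 2 ^ Fintype.card β * ∑ i, h i := by
  rw [Fintype.sum_prod_type, Finset.mul_sum]
  refine Finset.sum_congr rfl fun i _ => ?_
  simp

/-- It is unlikely that many wires of a gate with few wires stay free. -/
theorem card_le_liveCount (P : Finset (T × β)) {D : ℝ} (hD : 0 < D) (hP : P.card ≤ D) (m : ℕ) :
    (Fintype.card β / D) ^ m *
      ((Finset.univ.filter fun ρ : T → β × (β → Bool) => m ≤ liveCount P ρ).card : ℝ) ≤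
        3 * Fintype.card (T → β × (β → Bool)) := by
  set r : ℝ := Fintype.card β / D with hr
  have hr0 : 0 ≤ r := by positivity
  let g : T → β × (β → Bool) → ℝ := fun b q => if (b, q.1) ∈ P then 1 + r else 1
  have hg0 (b : T) (q : β × (β → Bool)) : 0 ≤ g b q := by
    simp only [g]; split_ifs <;> linarith
  have hprod (ρ : T → β × (β → Bool)) (h : m ≤ liveCount P ρ) : r ^ m ≤ ∏ b, g b (ρ b) := by
    calc r ^ m ≤ (1 + r) ^ m := pow_le_pow_left₀ hr0 (by linarith) m
      _ ≤ (1 + r) ^ liveCount P ρ := pow_le_pow_right₀ (by linarith) h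
      _ = ∏ b, g b (ρ b) := by simp [g, liveCount, Finset.prod_ite]
  let d : T → ℝ := fun b => ∑ i, if (b, i) ∈ P then 1 else 0
  have hd : ∑ b, d b = P.card := by
    simp only [d]
    rw [← Fintype.sum_prod_type' fun b i => if (b, i) ∈ P then (1 : ℝ) else 0]
    simp
  have hrow (b : T) : ∑ q, g b q ≤
      Fintype.card (β × (β → Bool)) * Real.exp (d b / D) := by
    have h1 : ∑ q, g b q = 2 ^ Fintype.card β * (Fintype.card β + r * d b) := by
      have h2 (q : β × (β → Bool)) : g b q = 1 + r * if (b, q.1) ∈ P then 1 else 0 := by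
        simp only [g]; split_ifs <;> ring
      rw [Finset.sum_congr rfl fun q _ => h2 q,
        sum_comp_fst fun i => 1 + r * if (b, i) ∈ P then 1 else 0, Finset.sum_add_distrib,
        ← Finset.mul_sum]
      simp [d]
    have h3 : 1 + d b / D ≤ Real.exp (d b / D) := by
      rw [add_comm]; exact Real.add_one_le_exp _
    calc ∑ q, g b q = Fintype.card (β × (β → Bool)) * (1 + d b / D) := by
          rw [h1, hr, Fintype.card_prod, Fintype.card_fun, Fintype.card_bool]
          push_cast
          ring
      _ ≤ _ := by gcongr
  calc r ^ m * ((Finset.univ.filter fun ρ : T → β × (β → Bool) => m ≤ liveCount P ρ).card : ℝ)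
      = ∑ ρ ∈ Finset.univ.filter fun ρ : T → β × (β → Bool) => m ≤ liveCount P ρ, r ^ m := by
        rw [Finset.sum_const, nsmul_eq_mul, mul_comm]
    _ ≤ ∑ ρ ∈ Finset.univ.filter fun ρ : T → β × (β → Bool) => m ≤ liveCount P ρ,
          ∏ b, g b (ρ b) := Finset.sum_le_sum fun ρ hρ => hprod ρ (Finset.mem_filter.1 hρ).2
    _ ≤ ∑ ρ : T → β × (β → Bool), ∏ b, g b (ρ b) :=
        Finset.sum_le_sum_of_subset_of_nonneg (Finset.filter_subset _ _) fun ρ _ _ =>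
          Finset.prod_nonneg fun b _ => hg0 b _
    _ = ∏ b, ∑ q, g b q := by rw [Finset.prod_univ_sum, Fintype.piFinset_univ]
    _ ≤ ∏ b, Fintype.card (β × (β → Bool)) * Real.exp (d b / D) :=
        Finset.prod_le_prod (fun b _ => Finset.sum_nonneg fun q _ => hg0 b q) fun b _ => hrow b
    _ = Fintype.card (T → β × (β → Bool)) * Real.exp (P.card / D) := by
        rw [Finset.prod_mul_distrib, ← Real.exp_sum, ← Finset.sum_div, hd, Fintype.card_fun]
        simp
    _ ≤ Fintype.card (T → β × (β → Bool)) * 3 := by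
        gcongr
        refine (Real.exp_le_exp.2 ((div_le_one hD).2 hP)).trans ?_
        exact (Real.exp_one_lt_d9.le.trans (by norm_num))
    _ = _ := mul_comm _ _

open Classical in
/-- A restriction under which few gates both survive and keep many wires. -/
theorem exists_restriction {I : Type} [Fintype I] [Nonempty β] (c : I → ℝ) (a : I → T → β → ℝ)
    (P : I → Finset (T × β)) {D : ℝ} (hD : 0 < D) {m : ℕ} (hm : m ≠ 0) :
    ∃ ρ : T → β × (β → Bool),
      ((Finset.univ.filter fun i => Survives (c i) (a i) ρ ∧ m ≤ liveCount (P i) ρ).card : ℝ) ≤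
        (Finset.univ.filter fun i => D < (P i).card).card *
            (Fintype.card T / √(Fintype.card β)) +
          (Finset.univ.filter fun i => P i ≠ ∅).card * (3 * (D / Fintype.card β) ^ m) := by
  set N : ℝ := (Fintype.card (T → β × (β → Bool)) : ℝ) with hN
  set B : ℝ := (Fintype.card β : ℝ) with hB
  have hB0 : 0 < B := by rw [hB]; exact_mod_cast Fintype.card_pos
  set u : ℝ := Fintype.card T / √B with hu
  set v : ℝ := 3 * (D / B) ^ m with hv
  have hu0 : 0 ≤ u := by positivity
  have hv0 : 0 ≤ v := by positivity
  let H : I → Finset (T → β × (β → Bool)) := fun i =>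
    Finset.univ.filter fun ρ => Survives (c i) (a i) ρ ∧ m ≤ liveCount (P i) ρ
  have hH (i : I) : ((H i).card : ℝ) ≤
      ((if D < (P i).card then u else 0) + if P i ≠ ∅ then v else 0) * N := by
    by_cases h1 : D < (P i).card
    · have h2 : ((H i).card : ℝ) ≤ u * N := by
        have h3 := card_survives_le (c i) (a i)
        have h4 : (H i).card ≤
            (Finset.univ.filter fun ρ : T → β × (β → Bool) => Survives (c i) (a i) ρ).card :=
          Finset.card_le_card fun ρ hρ => Finset.mem_filter.2
            ⟨Finset.mem_univ _, (Finset.mem_filter.1 hρ).2.1⟩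
        refine le_trans (Nat.cast_le.2 h4) (le_of_mul_le_mul_left (h3.trans (le_of_eq ?_)) hB0)
        rw [hu, ← hB, ← hN]
        field_simp
        rw [Real.sq_sqrt hB0.le]
        ring
      rw [if_pos h1]
      refine h2.trans (mul_le_mul_of_nonneg_right ?_ (by positivity))
      split_ifs <;> linarith
    · rw [if_neg h1, zero_add]
      by_cases h2 : P i = ∅
      · have : H i = ∅ := Finset.filter_eq_empty_iff.2 fun ρ _ h => hm (by
          have := h.2; simpa [liveCount, h2] using this)
        simp [this, h2]
      · rw [if_pos h2]
        have h3 := card_le_liveCount (P i) hD (not_lt.1 h1) m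
        have h4 : (H i).card ≤ (Finset.univ.filter fun ρ : T → β × (β → Bool) =>
            m ≤ liveCount (P i) ρ).card :=
          Finset.card_le_card fun ρ hρ => Finset.mem_filter.2
            ⟨Finset.mem_univ _, (Finset.mem_filter.1 hρ).2.2⟩
        have h5 : (0 : ℝ) < (B / D) ^ m := by positivity
        refine le_trans (Nat.cast_le.2 h4) (le_of_mul_le_mul_left (h3.trans (le_of_eq ?_)) h5)
        rw [hv, ← hN, ← mul_assoc, mul_left_comm, ← mul_pow, div_mul_div_comm, mul_comm B D,
          div_self (by positivity), one_pow, mul_one]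
  have hsum : ∑ ρ : T → β × (β → Bool), ((Finset.univ.filter fun i =>
      Survives (c i) (a i) ρ ∧ m ≤ liveCount (P i) ρ).card : ℝ) ≤
      ∑ ρ : T → β × (β → Bool), ((Finset.univ.filter fun i => D < (P i).card).card * u +
          (Finset.univ.filter fun i => P i ≠ ∅).card * v) := by
    calc _ = ∑ i, ((H i).card : ℝ) := by
          simp only [H, Finset.card_filter, Nat.cast_sum]
          exact Finset.sum_comm
      _ ≤ ∑ i, ((if D < (P i).card then u else 0) + if P i ≠ ∅ then v else 0) * N :=
          Finset.sum_le_sum fun i _ => hH i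
      _ = _ := by
          rw [← Finset.sum_mul, Finset.sum_add_distrib, ← Finset.sum_filter, ← Finset.sum_filter]
          simp only [Finset.sum_const, nsmul_eq_mul, Finset.card_univ, ← hN]
          ring
  obtain ⟨ρ, -, h⟩ := Finset.exists_le_of_sum_le Finset.univ_nonempty hsum
  exact ⟨ρ, h⟩

end Restriction

section FunctionClasses

variable {T : Type} [Fintype T] [DecidableEq T]

theorem finrank_span_range_le {X κ : Type} [Fintype κ] [Finite X] (F : κ → X → ℝ) :
    Module.finrank ℝ (Submodule.span ℝ (Set.range F)) ≤ Fintype.card κ :=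
  finrank_range_le_card F

/-- The functions that span the affine forms. -/
def affineGenerator : Option T → (T → Bool) → ℝ
  | none => fun _ => 1
  | some b => fun z => boolSign (z b)

open Classical in
/-- The threshold functions of the variables `T`. -/
noncomputable def thresholdFunctions (T : Type) [Fintype T] [DecidableEq T] :
    Finset ((T → Bool) → Bool) :=
  Finset.univ.filter fun g : (T → Bool) → Bool =>
    ∃ F ∈ Submodule.span ℝ (Set.range (affineGenerator (T := T))),
    ∀ z, g z = decide (0 < F z)

theorem card_thresholdFunctions_le :
    (thresholdFunctions T).card ≤ (2 ^ Fintype.card T + 1) ^ (Fintype.card T + 1) := by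
  classical
  have h := card_signPatterns_le _ ((finrank_span_range_le (affineGenerator (T := T))).trans
    (Fintype.card_option).le) (thresholdFunctions T) fun g hg => (Finset.mem_filter.1 hg).2
  simpa using h

open Classical in
theorem mem_thresholdFunctions (c : ℝ) (a : T → ℝ) :
    (fun z => decide (0 < c + ∑ b, a b * boolSign (z b))) ∈ thresholdFunctions T := by
  refine Finset.mem_filter.2 ⟨Finset.mem_univ _, c • affineGenerator (T := T) none +
    ∑ b, a b • affineGenerator (some b), ?_, fun z => ?_⟩
  · exact Submodule.add_mem _ (Submodule.smul_mem _ _ (Submodule.subset_span ⟨_, rfl⟩))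
      (Submodule.sum_mem _ fun b _ => Submodule.smul_mem _ _ (Submodule.subset_span ⟨_, rfl⟩))
  · simp [affineGenerator]

/-- The indicator function of an assignment to at most `m` variables. -/
def juntaGenerator {m : ℕ} (p : (Fin m → T) × (Fin m → Bool)) (z : T → Bool) : ℝ :=
  if (fun i => z (p.1 i)) = p.2 then 1 else 0

/-- The functions spanned by given Boolean functions and the functions of at most `m` variables. -/
def extendedSpan (m : ℕ) {r : ℕ} (h : Fin r → (T → Bool) → Bool) : Submodule ℝ ((T → Bool) → ℝ) :=
  Submodule.span ℝ (Set.range (Sum.elim (fun i z => boolSign (h i z))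
    (juntaGenerator (T := T) (m := m))))

theorem finrank_extendedSpan_le (m : ℕ) {r : ℕ} (h : Fin r → (T → Bool) → Bool) :
    Module.finrank ℝ (extendedSpan m h) ≤ r + (2 * Fintype.card T) ^ m := by
  refine (finrank_span_range_le _).trans (le_of_eq ?_)
  simp [mul_pow, mul_comm]

theorem generator_mem_extendedSpan (m : ℕ) {r : ℕ} (h : Fin r → (T → Bool) → Bool) (i : Fin r) :
    (fun z => boolSign (h i z)) ∈ extendedSpan m h :=
  Submodule.subset_span ⟨.inl i, rfl⟩

theorem junta_mem_extendedSpan [Nonempty T] {m : ℕ} {r : ℕ}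
    (h : Fin r → (T → Bool) → Bool) (S : Finset T) (hS : S.card ≤ m) (F : (T → Bool) → ℝ)
    (hF : ∀ z z', (∀ b ∈ S, z b = z' b) → F z = F z') : F ∈ extendedSpan m h := by
  obtain ⟨σ, hσ⟩ : ∃ σ : Fin m → T, ∀ b ∈ S, ∃ i, σ i = b := by
    rcases S.eq_empty_or_nonempty with rfl | hne
    · exact ⟨fun _ => Classical.arbitrary T, by simp⟩
    · have : Nonempty S := hne.to_subtype
      have hc : Nonempty (S ↪ Fin m) := Function.Embedding.nonempty_of_card_le (by simpa using hS)
      obtain ⟨e⟩ := hc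
      refine ⟨fun i => (Function.invFun e i : S), fun b hb => ⟨e ⟨b, hb⟩, ?_⟩⟩
      exact congrArg Subtype.val (Function.leftInverse_invFun e.injective _)
  let G : (Fin m → Bool) → ℝ := Function.extend (fun (z : T → Bool) i => z (σ i)) F 0
  have hG (z : T → Bool) : G (fun i => z (σ i)) = F z := by
    refine Function.FactorsThrough.extend_apply (f := fun (z : T → Bool) i => z (σ i))
      (fun z z' h => hF z z' fun b hb => ?_) 0 z
    obtain ⟨i, rfl⟩ := hσ b hb
    exact congrFun h i
  have : F = ∑ w, G w • juntaGenerator (σ, w) := by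
    funext z
    simp [juntaGenerator, hG]
  rw [this]
  exact Submodule.sum_mem _ fun w _ => Submodule.smul_mem _ _
    (Submodule.subset_span ⟨.inr (σ, w), rfl⟩)

open Classical in
/-- The threshold functions of at most `r` threshold functions and of functions of at most `m`
variables. -/
noncomputable def depthTwoFunctions (T : Type) [Fintype T] [DecidableEq T] (m r : ℕ) :
    Finset ((T → Bool) → Bool) :=
  Finset.univ.filter fun g => ∃ h : Fin r → (T → Bool) → Bool, (∀ i, h i ∈ thresholdFunctions T) ∧
    ∃ F ∈ extendedSpan m h, ∀ z, g z = decide (0 < F z)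

theorem card_depthTwoFunctions_le (m r : ℕ) :
    (depthTwoFunctions T m r).card ≤
      (2 ^ Fintype.card T + 1) ^ ((Fintype.card T + 2) * r + (2 * Fintype.card T) ^ m) := by
  classical
  let Q : (Fin r → (T → Bool) → Bool) → Finset ((T → Bool) → Bool) := fun h =>
    Finset.univ.filter fun g => ∃ F ∈ extendedSpan m h, ∀ z, g z = decide (0 < F z)
  have hQ (h : Fin r → (T → Bool) → Bool) :
      (Q h).card ≤ (2 ^ Fintype.card T + 1) ^ (r + (2 * Fintype.card T) ^ m) := by
    have := card_signPatterns_le _ (finrank_extendedSpan_le m h) (Q h)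
      fun g hg => (Finset.mem_filter.1 hg).2
    simpa using this
  have hsub : depthTwoFunctions T m r ⊆
      (Fintype.piFinset fun _ : Fin r => thresholdFunctions T).biUnion Q := fun g hg => by
    obtain ⟨h, hh, hF⟩ := (Finset.mem_filter.1 hg).2
    exact Finset.mem_biUnion.2 ⟨h, Fintype.mem_piFinset.2 hh,
      Finset.mem_filter.2 ⟨Finset.mem_univ _, hF⟩⟩
  refine (Finset.card_le_card hsub).trans ((Finset.card_biUnion_le_card_mul _ _ _
    fun h _ => hQ h).trans ?_)
  rw [Fintype.card_piFinset, Finset.prod_const, Finset.card_univ, Fintype.card_fin]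
  calc _ ≤ ((2 ^ Fintype.card T + 1) ^ (Fintype.card T + 1)) ^ r *
        (2 ^ Fintype.card T + 1) ^ (r + (2 * Fintype.card T) ^ m) := by
        gcongr
        exact card_thresholdFunctions_le
    _ = _ := by rw [← pow_mul, ← pow_add]; congr 1; ring

end FunctionClasses

/-- Some message has a codeword that does not correlate with any function of a small class. -/
theorem exists_uncorrelated {Ω Z : Type} [Fintype Ω] [Nonempty Ω] {k : ℕ}
    (F : (Fin k → ZMod 2) → Ω → Bool) (address : Ω → Z) (𝒢 : Finset (Z → Bool)) {κ δ : ℝ}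
    (hδ : 0 ≤ δ) (hκ : 0 ≤ κ)
    (horth : ∀ x x', x ≠ x' →
      |∑ ω, boolSign (F x ω) * boolSign (F x' ω)| ≤ κ * Fintype.card Ω)
    (hcard : (𝒢.card : ℝ) < 2 ^ k * (δ ^ 2 - κ)) :
    ∃ x, ∀ g ∈ 𝒢, |∑ ω, boolSign (F x ω) * boolSign (g (address ω))| < δ * Fintype.card Ω := by
  classical
  by_contra! hcon
  choose g hg hcorr using hcon
  have hfib (h : Z → Bool) :
      ((Finset.univ.filter fun x => g x = h).card : ℝ) * (δ ^ 2 - κ) ≤ 1 := by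
    refine card_correlated_le _ F (fun ω => h (address ω)) hδ hκ
      (fun x _ x' _ hne => horth x x' hne) fun x hx => ?_
    rw [← (Finset.mem_filter.1 hx).2]
    exact hcorr x
  have htotal : (2 ^ k : ℕ) = ∑ h ∈ 𝒢, (Finset.univ.filter fun x => g x = h).card := by
    rw [← Finset.card_eq_sum_card_fiberwise fun x _ => hg x]
    simp [ZMod.card]
  have htotal' : (2 : ℝ) ^ k = ∑ h ∈ 𝒢, ((Finset.univ.filter fun x => g x = h).card : ℝ) := by
    exact_mod_cast htotal
  rw [htotal', Finset.sum_mul] at hcard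
  refine hcard.not_ge ((Finset.sum_le_sum fun h _ => hfib h).trans ?_)
  simp

section Circuits

variable {T β : Type} [Fintype T] [DecidableEq T] [Fintype β] [DecidableEq β]

/-- The values of the variables when the free variables are chosen such that the parities of the
blocks are given. -/
def withParities (ρ : T → β × (β → Bool)) (z : T → Bool) (v : T × β) : Bool :=
  if v.2 = (ρ v.1).1 then
    xor (z v.1) (zbit (∑ i ∈ Finset.univ.erase (ρ v.1).1, bitZ ((ρ v.1).2 i)))
  else (ρ v.1).2 v.2

theorem blockParity_withParities (ρ : T → β × (β → Bool)) (z : T → Bool) (b : T) :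
    (blockParity fun i => withParities ρ z (b, i)) = z b := by
  rw [blockParity, ← Finset.sum_erase_add _ _ (Finset.mem_univ (ρ b).1),
    Finset.sum_congr rfl fun i hi => show _ = bitZ ((ρ b).2 i) by
      simp [withParities, Finset.ne_of_mem_erase hi], zbit_add, zbit_bitZ]
  simp only [withParities, if_true]
  cases z b <;> simp

/-- The shift between the block parities and the values of the free variables. -/
def parityShift (ρ : T → β × (β → Bool)) (z : T → Bool) (b : T) : Bool :=
  xor (z b) (zbit (∑ i ∈ Finset.univ.erase (ρ b).1, bitZ ((ρ b).2 i)))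

theorem sum_withParities (c : ℝ) (a : T → β → ℝ) (ρ : T → β × (β → Bool)) (z : T → Bool) :
    c + ∑ b, ∑ i, a b i * boolSign (withParities ρ z (b, i)) =
      restrictedForm c a ρ (parityShift ρ z) := by
  rw [restrictedForm]
  congr 1
  refine Finset.sum_congr rfl fun b _ => ?_
  rw [← Finset.sum_erase_add _ _ (Finset.mem_univ (ρ b).1), fixedPart,
    Finset.sum_congr rfl fun i hi => show _ = a b i * boolSign ((ρ b).2 i) by
      simp [withParities, Finset.ne_of_mem_erase hi]]
  simp [withParities, parityShift]

open Classical in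
theorem decide_restrictedForm_mem (c : ℝ) (a : T → β → ℝ) (ρ : T → β × (β → Bool)) :
    (fun z => decide (0 < restrictedForm c a ρ (parityShift ρ z))) ∈ thresholdFunctions T := by
  convert! mem_thresholdFunctions (c + ∑ b, fixedPart (a b) (ρ b)) fun b => a b (ρ b).1 *
    -boolSign (zbit (∑ i ∈ Finset.univ.erase (ρ b).1, bitZ ((ρ b).2 i))) using 5 with z
  rw [restrictedForm, Finset.sum_add_distrib, ← add_assoc]
  congr 1
  refine Finset.sum_congr rfl fun b _ => ?_
  rw [parityShift]
  generalize zbit _ = s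
  cases s <;> cases z b <;> simp [boolSign]

open Classical in
theorem boolSign_restrictedForm_mem [Nonempty T] {m : ℕ} {r : ℕ}
    (h : Fin r → (T → Bool) → Bool) (c : ℝ) (a : T → β → ℝ) (ρ : T → β × (β → Bool))
    (P : Finset (T × β)) (hP : ∀ b i, (b, i) ∉ P → a b i = 0)
    (hρ : ¬ (Survives c a ρ ∧ m ≤ liveCount P ρ)) :
    (fun z => boolSign (decide (0 < restrictedForm c a ρ (parityShift ρ z)))) ∈
      extendedSpan m h := by
  by_cases hs : Survives c a ρ
  · have hlive : liveCount P ρ ≤ m := (not_le.1 fun hle => hρ ⟨hs, hle⟩).le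
    refine junta_mem_extendedSpan h (Finset.univ.filter fun b => (b, (ρ b).1) ∈ P) hlive _
      fun z z' hz => ?_
    have : restrictedForm c a ρ (parityShift ρ z) = restrictedForm c a ρ (parityShift ρ z') := by
      simp only [restrictedForm]
      congr 1
      refine Finset.sum_congr rfl fun b _ => ?_
      by_cases hb : (b, (ρ b).1) ∈ P
      · rw [parityShift, parityShift, hz b (Finset.mem_filter.2 ⟨Finset.mem_univ _, hb⟩)]
      · rw [hP _ _ hb]; ring
    rw [this]
  · refine junta_mem_extendedSpan h ∅ (by simp) _ fun z z' _ => ?_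
    have hiff : 0 < restrictedForm c a ρ (parityShift ρ z) ↔
        0 < restrictedForm c a ρ (parityShift ρ z') := by
      constructor <;> intro h1 <;> by_contra h2 <;> exact hs ⟨_, _, h1, not_lt.1 h2⟩
    simp only [hiff]

/-- The input of a circuit, where the positions carry constants or variables. -/
def substitute {N : ℕ} (p : Fin N → Bool ⊕ T × β) (y : T × β → Bool) (j : Fin N) : Bool :=
  Sum.elim id y (p j)

namespace ThresholdGate

variable {N : ℕ} (φ : ThresholdGate (Fin N)) (p : Fin N → Bool ⊕ T × β)

/-- The coefficients of the variables after a substitution. -/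
def coeff (b : T) (i : β) : ℝ := ∑ j ∈ φ.inputs, if p j = .inr (b, i) then φ.weight j else 0

/-- The constant term after a substitution. -/
def constTerm : ℝ :=
  (∑ j ∈ φ.inputs, Sum.elim (fun e => φ.weight j * boolSign e) (fun _ => 0) (p j)) - φ.threshold

/-- The variables that are wired to the gate after a substitution. -/
def wired : Finset (T × β) := Finset.univ.filter fun v => ∃ j ∈ φ.inputs, p j = .inr v

theorem card_wired_le : (φ.wired p).card ≤ φ.fanIn := by
  classical
  have : ((φ.wired p).image (Sum.inr : T × β → Bool ⊕ T × β)) ⊆ φ.inputs.image p := fun w hw => by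
    obtain ⟨v, hv, rfl⟩ := Finset.mem_image.1 hw
    obtain ⟨j, hj, h⟩ := (Finset.mem_filter.1 hv).2
    exact Finset.mem_image.2 ⟨j, hj, h⟩
  rw [← Finset.card_image_of_injective _ (Sum.inr_injective : Function.Injective
    (Sum.inr : T × β → Bool ⊕ T × β))]
  exact (Finset.card_le_card this).trans Finset.card_image_le

theorem coeff_eq_zero {b : T} {i : β} (h : (b, i) ∉ φ.wired p) : φ.coeff p b i = 0 := by
  refine Finset.sum_eq_zero fun j hj => if_neg fun hp => h ?_
  exact Finset.mem_filter.2 ⟨Finset.mem_univ _, j, hj, hp⟩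

theorem eval_substitute (y : T × β → Bool) :
    φ.eval (substitute p y) =
      decide (0 < φ.constTerm p + ∑ b, ∑ i, φ.coeff p b i * boolSign (y (b, i))) := by
  have h : ∑ j ∈ φ.inputs, φ.weight j * boolSign (substitute p y j) - φ.threshold =
      φ.constTerm p + ∑ b, ∑ i, φ.coeff p b i * boolSign (y (b, i)) := by
    have h1 : ∑ b, ∑ i, φ.coeff p b i * boolSign (y (b, i)) =
        ∑ j ∈ φ.inputs, ∑ v : T × β, if p j = .inr v then φ.weight j * boolSign (y v) else 0 := by
      conv_rhs => rw [Finset.sum_comm, Fintype.sum_prod_type]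
      simp only [coeff, Finset.sum_mul, ite_mul, zero_mul]
    rw [h1, constTerm, sub_add_eq_add_sub, ← Finset.sum_add_distrib]
    congr 1
    refine Finset.sum_congr rfl fun j _ => ?_
    rw [substitute]
    cases p j with
    | inl e => simp
    | inr v => simp
  rw [eval, h]

end ThresholdGate

open Classical in
/-- A circuit with few bottom gates does not compute a function that, on suitable inputs, has small
correlation with all depth two functions of the block parities. -/
theorem MajThrThrCircuit.not_uncorrelated {N : ℕ} (C : MajThrThrCircuit N)
    (p : Fin N → Bool ⊕ T × β) [Nonempty T] [Nonempty β] {Ω : Type} [Fintype Ω] [Nonempty Ω]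
    (address : Ω → T → Bool) (f : Ω → Bool)
    (hC : ∀ ω y, (∀ b, (blockParity fun i => y (b, i)) = address ω b) →
      C.eval (substitute p y) = f ω)
    {D δ : ℝ} (hD : 0 < D) {m r : ℕ} (hm : m ≠ 0) (hδ : δ ≤ 1 / (4 * (C.top.fanIn + 1)))
    (hf : ∀ g ∈ depthTwoFunctions T m r,
      |∑ ω, boolSign (f ω) * boolSign (g (address ω))| < δ * Fintype.card Ω) :
    (r : ℝ) + 1 ≤ (Finset.univ.filter fun i => D < (C.bottom i).fanIn).card *
        (Fintype.card T / √(Fintype.card β)) +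
      (Finset.univ.filter fun i => (C.bottom i).fanIn ≠ 0).card *
        (3 * (D / Fintype.card β) ^ m) := by
  by_contra! hr
  obtain ⟨ρ, hρ⟩ := exists_restriction (fun i => (C.bottom i).constTerm p)
    (fun i => (C.bottom i).coeff p) (fun i => (C.bottom i).wired p) hD hm
  set hard : Finset (Fin C.numBottom) := Finset.univ.filter fun i =>
    Survives ((C.bottom i).constTerm p) ((C.bottom i).coeff p) ρ ∧
      m ≤ liveCount ((C.bottom i).wired p) ρ with hhard
  have hcard : hard.card ≤ r := by
    have h1 : (hard.card : ℝ) < r + 1 := by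
      refine (hρ.trans ?_).trans_lt hr
      have hle (i : Fin C.numBottom) := (C.bottom i).card_wired_le p
      refine add_le_add (mul_le_mul_of_nonneg_right (Nat.cast_le.2 (Finset.card_le_card
        (Finset.monotone_filter_right _ fun i _ h => h.trans_le (Nat.cast_le.2 (hle i)))))
          (by positivity)) (mul_le_mul_of_nonneg_right (Nat.cast_le.2 (Finset.card_le_card
        (Finset.monotone_filter_right _ fun i _ h h0 => h (Finset.card_eq_zero.1 ?_))))
          (by positivity))
      exact Nat.le_zero.1 ((hle i).trans h0.le)
    have h2 : hard.card < r + 1 := by exact_mod_cast h1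
    omega
  let g : Fin C.numBottom → (T → Bool) → Bool := fun i z =>
    (C.bottom i).eval (substitute p (withParities ρ z))
  have hg (i : Fin C.numBottom) : g i = fun z => decide (0 < restrictedForm
      ((C.bottom i).constTerm p) ((C.bottom i).coeff p) ρ (parityShift ρ z)) := by
    funext z
    rw [← sum_withParities]
    exact (C.bottom i).eval_substitute p _
  obtain ⟨h, hh, hrange⟩ : ∃ h : Fin r → (T → Bool) → Bool, (∀ i, h i ∈ thresholdFunctions T) ∧
      ∀ i ∈ hard, ∃ j, h j = g i := by
    obtain ⟨e⟩ : Nonempty (hard ↪ Fin r) :=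
      Function.Embedding.nonempty_of_card_le (by simpa using hcard)
    refine ⟨Function.extend e (fun i => g i) fun _ _ => decide (0 < (0 : ℝ) +
      ∑ b : T, (0 : ℝ) * boolSign true), fun j => ?_, fun i hi => ⟨e ⟨i, hi⟩, ?_⟩⟩
    · by_cases hj : ∃ i, e i = j
      · obtain ⟨i, rfl⟩ := hj
        rw [e.injective.extend_apply, hg]
        exact decide_restrictedForm_mem _ _ _
      · rw [Function.extend_apply' _ _ _ hj]
        simpa using mem_thresholdFunctions (T := T) 0 0
    · rw [e.injective.extend_apply]
  have hspan (i : Fin C.numBottom) : (fun z => boolSign (g i z)) ∈ extendedSpan m h := by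
    by_cases hi : i ∈ hard
    · obtain ⟨j, hj⟩ := hrange i hi
      rw [← hj]
      exact generator_mem_extendedSpan m h j
    · rw [hg]
      exact boolSign_restrictedForm_mem h _ _ ρ _ (fun b i => (C.bottom _).coeff_eq_zero p)
        fun hcon => hi (Finset.mem_filter.2 ⟨Finset.mem_univ _, hcon⟩)
  have hconst (c : ℝ) : (fun _ => c) ∈ extendedSpan m h :=
    junta_mem_extendedSpan h ∅ (by simp) _ fun _ _ _ => rfl
  let G : Fin C.numMiddle → (T → Bool) → Bool := fun j z => (C.middle j).eval fun i => g i z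
  have hG (j : Fin C.numMiddle) : G j ∈ depthTwoFunctions T m r := by
    refine Finset.mem_filter.2 ⟨Finset.mem_univ _, h, hh, ∑ i ∈ (C.middle j).inputs,
      (C.middle j).weight i • (fun z => boolSign (g i z)) - fun _ => (C.middle j).threshold,
      Submodule.sub_mem _ (Submodule.sum_mem _ fun i _ => Submodule.smul_mem _ _ (hspan i))
        (hconst _), fun z => ?_⟩
    simp [G, ThresholdGate.eval]
  have hone : (fun _ => true) ∈ depthTwoFunctions T m r :=
    Finset.mem_filter.2 ⟨Finset.mem_univ _, h, hh, _, hconst 1, fun z => by simp⟩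
  obtain ⟨q, hq, hcorr⟩ := C.top_majority.exists_correlated fun j ω => G j (address ω)
  have hfω (ω : Ω) : (C.top.eval fun j => G j (address ω)) = f ω :=
    hC ω (withParities ρ (address ω)) fun b => blockParity_withParities ρ _ b
  simp only [hfω] at hcorr
  have hle : δ * (Fintype.card Ω : ℝ) ≤ |∑ ω, boolSign (f ω) * boolSign (q ω)| :=
    (mul_le_mul_of_nonneg_right hδ (by positivity)).trans hcorr
  rcases hq with ⟨j, rfl⟩ | rfl
  · exact (hf _ (hG j)).not_ge hle
  · exact (hf _ hone).not_ge hle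

end Circuits

open ShiftRegister in
theorem encode_map_fill {V : Type} (y : V → Bool) (L : List (Bool × Bool × (Bool ⊕ V))) :
    encode (L.map (fill y)) =
      (L.flatMap fun c => [.inl c.1, .inl c.2.1, c.2.2]).map (Sum.elim id y) := by
  induction L with
  | nil => rfl
  | cons c L ih =>
    change c.1 :: c.2.1 :: Sum.elim id y c.2.2 :: encode (L.map (fill y)) = _
    rw [ih]
    rfl

theorem ofFn_map_get {α γ : Type} (w : List α) {N : ℕ} (h : N = w.length) (f : α → γ) :
    (List.ofFn fun j : Fin N => f (w.get (Fin.cast h j))) = w.map f := by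
  subst h
  exact List.ext_get (by simp) fun n h₁ h₂ => by simp

open Classical ShiftRegister in
theorem MajThrThrCircuit.Computes.le_of_output {ℓ k B m r N : ℕ} (hℓ : ℓ ≠ 0) (hB : B ≠ 0)
    (hm : m ≠ 0) {D μ : ℝ} (hD : 0 < D) (hμ : 0 ≤ μ) (hN : N = 3 * (ℓ * (2 * B + 1) + k))
    (hcount : ((2 : ℝ) ^ (2 * ℓ) + 1) ^ ((2 * ℓ + 2) * r + (4 * ℓ) ^ m) <
      2 ^ k * ((1 / (4 * (μ + 1))) ^ 2 - k / 2 ^ ℓ))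
    {C : MajThrThrCircuit N} (hC : C.Computes (slice output N)) (htop : C.top.fanIn ≤ μ) :
    (r : ℝ) + 1 ≤ (Finset.univ.filter fun i => D < (C.bottom i).fanIn).card * (2 * ℓ / √B) +
      (Finset.univ.filter fun i => (C.bottom i).fanIn ≠ 0).card * (3 * (D / B) ^ m) := by
  obtain ⟨Ω, _, address, F, hΩ, horth, hF⟩ := exists_code k ℓ hℓ
  have : Nonempty Ω := Fintype.card_pos_iff.1 (by rw [hΩ]; positivity)
  have : Nonempty (Fin B) := ⟨⟨0, Nat.pos_of_ne_zero hB⟩⟩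
  have : Nonempty (Fin ℓ) := ⟨⟨0, Nat.pos_of_ne_zero hℓ⟩⟩
  have hT : Fintype.card (Fin ℓ × Bool) = 2 * ℓ := by simp [mul_comm]
  obtain ⟨x, hx⟩ := exists_uncorrelated F address (depthTwoFunctions (Fin ℓ × Bool) m r)
    (κ := k / 2 ^ ℓ) (δ := 1 / (4 * (μ + 1))) (by positivity) (by positivity)
    (fun x x' h => (horth x x' h).trans (le_of_eq (by rw [hΩ]; push_cast; field_simp)))
    (lt_of_le_of_lt (by
      have := card_depthTwoFunctions_le (T := Fin ℓ × Bool) m r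
      rw [hT, ← mul_assoc] at this
      exact_mod_cast this) hcount)
  let w : List (Bool ⊕ (Fin ℓ × Bool) × Fin B) :=
    (template B x).flatMap fun c => [.inl c.1, .inl c.2.1, c.2.2]
  have hw : N = w.length := by
    have h1 := congrArg List.length (encode_map_fill (fun _ => true)
      (template B x : List (Bool × Bool × (Bool ⊕ (Fin ℓ × Bool) × Fin B))))
    rw [length_encode, List.length_map, List.length_map, length_template] at h1
    exact hN.trans h1
  have h := C.not_uncorrelated (T := Fin ℓ × Bool) (β := Fin B)
    (fun j => w.get (Fin.cast hw j)) address (F x) (fun ω y hy => ?_) hD hm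
    (one_div_le_one_div_of_le (by positivity) (by linarith)) hx
  · rw [hT, Fintype.card_fin] at h
    exact_mod_cast h
  · rw [hC, slice, ← hF B x ω y hy, encode_map_fill]
    exact congrArg output (ofFn_map_get w hw (Sum.elim id y))

namespace MajThrThrCircuit

variable {N : ℕ} (C : MajThrThrCircuit N)

theorem top_fanIn_le_gates : C.top.fanIn ≤ C.gates := by
  have := Finset.card_le_univ C.top.inputs
  rw [Fintype.card_fin] at this
  rw [ThresholdGate.fanIn, gates]
  omega

theorem top_fanIn_le_wires : C.top.fanIn ≤ C.wires := by
  rw [wires]; omega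

theorem card_filter_bottom_le_gates (q : Fin C.numBottom → Prop) [DecidablePred q] :
    (Finset.univ.filter q).card ≤ C.gates := by
  have := Finset.card_le_univ (Finset.univ.filter q)
  rw [Fintype.card_fin] at this
  rw [gates]
  omega

theorem sum_fanIn_le_wires : ∑ i, (C.bottom i).fanIn ≤ C.wires := by
  rw [wires]; omega

theorem card_nonempty_le_wires :
    (Finset.univ.filter fun i => (C.bottom i).fanIn ≠ 0).card ≤ C.wires := by
  refine le_trans ?_ C.sum_fanIn_le_wires
  rw [Finset.card_filter]
  refine Finset.sum_le_sum fun i _ => ?_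
  split_ifs <;> omega

open Classical in
theorem card_large_mul_le_wires (D : ℝ) :
    (Finset.univ.filter fun i => D < (C.bottom i).fanIn).card * D ≤ C.wires := by
  refine le_trans ?_ (Nat.cast_le.2 C.sum_fanIn_le_wires)
  rw [← nsmul_eq_mul, ← Finset.sum_const, Nat.cast_sum]
  exact (Finset.sum_le_sum fun i hi => (Finset.mem_filter.1 hi).2.le).trans
    (Finset.sum_le_sum_of_subset_of_nonneg (Finset.filter_subset _ _) fun _ _ _ => by positivity)

end MajThrThrCircuit

/-- Half of the input length for which the lower bound is shown. -/
def halfLength (s : ℕ) : ℕ := 30 * s * (2 * 2 ^ s + 1)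

theorem halfLength_le {s : ℕ} : (halfLength s : ℝ) ≤ 90 * s * 2 ^ s := by
  have h : (1 : ℝ) ≤ 2 ^ s := one_le_pow₀ (by norm_num)
  have hs : (0 : ℝ) ≤ s := by positivity
  rw [halfLength]
  push_cast
  nlinarith

theorem eventually_count (η : ℝ) (hη : 0 < η) (m : ℕ) : ∀ᶠ s : ℕ in atTop,
    128 * (90 * (s : ℝ)) ^ 6 ≤ 2 ^ s ∧
      21 * (22 * s * ((90 * s) ^ 4 * ((2 : ℝ) ^ s) ^ (1 - η / 2)) + (40 * s) ^ m) + 7 <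
        20 * (2 : ℝ) ^ s := by
  set c : ℝ := (2 : ℝ) ^ (-(η / 2)) with hc
  have hc0 : 0 < c := by positivity
  have hc1 : c < 1 := Real.rpow_lt_one_of_one_lt_of_neg (by norm_num) (by linarith)
  have half : |(1 / 2 : ℝ)| < 1 := by rw [abs_of_pos] <;> norm_num
  have t1 := (tendsto_pow_const_mul_const_pow_of_abs_lt_one 6 half).const_mul (128 * 90 ^ 6)
  have t2 := ((tendsto_pow_const_mul_const_pow_of_abs_lt_one 5
    (show |c| < 1 by rwa [abs_of_pos hc0])).const_mul (21 * 22 * 90 ^ 4)).add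
      (((tendsto_pow_const_mul_const_pow_of_abs_lt_one m half).const_mul (21 * 40 ^ m)).add
        ((tendsto_pow_const_mul_const_pow_of_abs_lt_one 0 half).const_mul 7))
  rw [mul_zero] at t1
  rw [mul_zero, mul_zero, mul_zero, add_zero, add_zero] at t2
  filter_upwards [t1.eventually (gt_mem_nhds one_pos),
    t2.eventually (gt_mem_nhds (show (0 : ℝ) < 20 by norm_num))] with s h1 h2
  have hb : (0 : ℝ) < 2 ^ s := by positivity
  have hhalf : (1 / 2 : ℝ) ^ s * 2 ^ s = 1 := by rw [← mul_pow]; norm_num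
  have hrp : ((2 : ℝ) ^ s) ^ (1 - η / 2) = c ^ s * 2 ^ s := by
    rw [sub_eq_neg_add, Real.rpow_add hb, Real.rpow_one, hc, ← Real.rpow_natCast,
      ← Real.rpow_natCast, ← Real.rpow_mul (by norm_num), ← Real.rpow_mul (by norm_num),
      mul_comm (s : ℝ)]
  constructor
  · have := mul_lt_mul_of_pos_right h1 hb
    have e : 128 * 90 ^ 6 * ((s : ℝ) ^ 6 * (1 / 2) ^ s) * 2 ^ s =
        128 * (90 * (s : ℝ)) ^ 6 * ((1 / 2 : ℝ) ^ s * 2 ^ s) := by ring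
    rw [e, hhalf] at this
    linarith
  · have := mul_lt_mul_of_pos_right h2 hb
    have e : (21 * 22 * 90 ^ 4 * ((s : ℝ) ^ 5 * c ^ s) + (21 * 40 ^ m * ((s : ℝ) ^ m * (1 / 2) ^ s) +
        7 * ((s : ℝ) ^ 0 * (1 / 2) ^ s))) * 2 ^ s =
        21 * 22 * 90 ^ 4 * s ^ 5 * (c ^ s * 2 ^ s) + (21 * 40 ^ m * s ^ m + 7) *
          ((1 / 2 : ℝ) ^ s * 2 ^ s) := by ring
    rw [e, hhalf] at this
    rw [hrp, mul_pow 40]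
    refine lt_of_le_of_lt (le_of_eq ?_) this
    ring

theorem count_of_parameters {s m r : ℕ} {η : ℝ} (hs : 1 ≤ s)
    (hr : (r : ℝ) ≤ (90 * s) ^ 4 * ((2 : ℝ) ^ s) ^ (1 - η / 2))
    (h₁ : 128 * (90 * (s : ℝ)) ^ 6 ≤ 2 ^ s)
    (h₂ : 21 * (22 * s * ((90 * s) ^ 4 * ((2 : ℝ) ^ s) ^ (1 - η / 2)) + (40 * s) ^ m) + 7 <
      20 * (2 : ℝ) ^ s) :
    ((2 : ℝ) ^ (2 * (10 * s)) + 1) ^ ((2 * (10 * s) + 2) * r + (4 * (10 * s)) ^ m) <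
      2 ^ (10 * s * (2 * 2 ^ s + 1)) * ((1 / (4 * ((halfLength s : ℝ) ^ 3 + 1))) ^ 2 -
        ((10 * s * (2 * 2 ^ s + 1) : ℕ) : ℝ) / 2 ^ (10 * s)) := by
  have hs' : (1 : ℝ) ≤ s := by exact_mod_cast hs
  set b : ℝ := (2 : ℝ) ^ s with hb
  have hb1 : 1 ≤ b := one_le_pow₀ (by norm_num)
  set E : ℕ := (2 * (10 * s) + 2) * r + (4 * (10 * s)) ^ m with hE
  set k : ℕ := 10 * s * (2 * 2 ^ s + 1) with hk
  have hk' : (k : ℝ) = 10 * s * (2 * b + 1) := by rw [hk, hb]; push_cast; ring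
  have hER : (E : ℝ) ≤ 22 * s * ((90 * s) ^ 4 * b ^ (1 - η / 2)) + (40 * s) ^ m := by
    rw [hE]
    push_cast
    have e : (4 * (10 * (s : ℝ))) = 40 * s := by ring
    rw [e]
    gcongr
    linarith
  have hexp : 21 * s * E + 7 * s < k := by
    have : (21 * s * E + 7 * s : ℝ) < k := by
      rw [hk']
      have h3 : 21 * (E : ℝ) + 7 < 20 * b := by linarith
      nlinarith
    exact_mod_cast this
  have hlhs : ((2 : ℝ) ^ (2 * (10 * s)) + 1) ^ E ≤ 2 ^ (21 * s * E) := by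
    rw [pow_mul 2 (21 * s)]
    gcongr
    have h3 : (2 : ℝ) ^ (21 * s) = 2 ^ (2 * (10 * s)) * 2 ^ s := by rw [← pow_add]; congr 1; ring
    have h4 : (2 : ℝ) ≤ 2 ^ s := le_self_pow₀ (by norm_num) (by omega)
    have h5 : (1 : ℝ) ≤ 2 ^ (2 * (10 * s)) := one_le_pow₀ (by norm_num)
    rw [h3]
    nlinarith
  have hn : (4 * ((halfLength s : ℝ) ^ 3 + 1)) ^ 2 ≤ b ^ 7 / 2 := by
    have hle := halfLength_le (s := s)
    have h1n : 1 ≤ (90 * s * b) ^ 3 := one_le_pow₀ (by nlinarith)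
    calc (4 * ((halfLength s : ℝ) ^ 3 + 1)) ^ 2 ≤ (4 * ((90 * s * b) ^ 3 + (90 * s * b) ^ 3)) ^ 2 := by
          gcongr
      _ = 128 * (90 * (s : ℝ)) ^ 6 * b ^ 6 / 2 := by ring
      _ ≤ b * b ^ 6 / 2 := by gcongr
      _ = b ^ 7 / 2 := by ring
  have hbr : 1 / b ^ 7 ≤ (1 / (4 * ((halfLength s : ℝ) ^ 3 + 1))) ^ 2 - (k : ℝ) / 2 ^ (10 * s) := by
    have h3 : 2 / b ^ 7 ≤ (1 / (4 * ((halfLength s : ℝ) ^ 3 + 1))) ^ 2 := by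
      rw [div_pow, one_pow, ← one_div_div]
      exact one_div_le_one_div_of_le (by positivity) hn
    have h4 : (k : ℝ) / 2 ^ (10 * s) ≤ 1 / b ^ 7 := by
      have e : (2 : ℝ) ^ (10 * s) = b ^ 7 * b ^ 3 := by rw [hb, ← pow_add, ← pow_mul, mul_comm]
      rw [e, div_le_div_iff₀ (by positivity) (by positivity), one_mul, mul_comm]
      gcongr
      rw [hk']
      have h5 : 30 * (s : ℝ) ≤ b := by
        have : (90 * (s : ℝ)) ≤ (90 * (s : ℝ)) ^ 6 := le_self_pow₀ (by linarith) (by norm_num)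
        nlinarith
      calc 10 * s * (2 * b + 1) ≤ 30 * s * b := by nlinarith
        _ ≤ b * b := by gcongr
        _ ≤ b ^ 3 := by nlinarith [sq_nonneg b]
    have e : (2 : ℝ) / b ^ 7 = 1 / b ^ 7 + 1 / b ^ 7 := by ring
    linarith
  calc ((2 : ℝ) ^ (2 * (10 * s)) + 1) ^ E ≤ 2 ^ (21 * s * E) := hlhs
    _ < 2 ^ k * (1 / b ^ 7) := by
        rw [mul_one_div, lt_div_iff₀ (by positivity), hb, ← pow_mul, ← pow_add, mul_comm s 7]
        exact pow_lt_pow_right₀ (by norm_num) hexp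
    _ ≤ _ := by gcongr

theorem sparse_bound {s m : ℕ} {η x y : ℝ} (hs : 1 ≤ s) (hη : 0 < η) (hη1 : η ≤ 1)
    (hm : 6 ≤ η * m)
    (hx : x * ((2 : ℝ) ^ s) ^ (1 - η / 2) ≤ (halfLength s : ℝ) ^ ((5 : ℝ) / 2 - η))
    (hy : y ≤ (halfLength s : ℝ) ^ 3) :
    x * (2 * (10 * s : ℕ) / √((2 ^ s : ℕ) : ℝ)) +
      y * (3 * (((2 : ℝ) ^ s) ^ (1 - η / 2) / ((2 ^ s : ℕ) : ℝ)) ^ m) ≤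
        (90 * s) ^ 4 * ((2 : ℝ) ^ s) ^ (1 - η / 2) := by
  have hs' : (1 : ℝ) ≤ s := by exact_mod_cast hs
  push_cast
  set b : ℝ := (2 : ℝ) ^ s with hb
  have hb1 : 1 ≤ b := one_le_pow₀ (by norm_num)
  have hb0 : 0 < b := by linarith
  have hle : (halfLength s : ℝ) ≤ 90 * s * b := halfLength_le
  set D : ℝ := b ^ (1 - η / 2) with hD
  have hD0 : 0 < D := by positivity
  have hD1 : 1 ≤ D := Real.one_le_rpow hb1 (by linarith)
  have h1 : (halfLength s : ℝ) ^ ((5 : ℝ) / 2 - η) ≤ (90 * s) ^ 3 * (D * (D * √b)) := by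
    calc (halfLength s : ℝ) ^ ((5 : ℝ) / 2 - η) ≤ (90 * s * b) ^ ((5 : ℝ) / 2 - η) :=
          Real.rpow_le_rpow (by positivity) hle (by linarith)
      _ = (90 * s) ^ ((5 : ℝ) / 2 - η) * b ^ ((5 : ℝ) / 2 - η) :=
          Real.mul_rpow (by positivity) hb0.le
      _ ≤ (90 * s) ^ (3 : ℝ) * (D * (D * √b)) := by
          refine mul_le_mul (Real.rpow_le_rpow_of_exponent_le (by linarith) (by linarith))
            (le_of_eq ?_) (by positivity) (by positivity)
          rw [hD, Real.sqrt_eq_rpow, ← Real.rpow_add hb0, ← Real.rpow_add hb0]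
          congr 1
          ring
      _ = _ := by norm_cast
  have h2 : x * (2 * (10 * s) / √b) ≤ 20 * s * (90 * s) ^ 3 * D := by
    have h3 : x ≤ (90 * s) ^ 3 * (D * √b) := by
      refine le_of_mul_le_mul_right ((hx.trans h1).trans (le_of_eq ?_)) hD0
      ring
    calc x * (2 * (10 * s) / √b) ≤ (90 * s) ^ 3 * (D * √b) * (2 * (10 * s) / √b) := by gcongr
      _ = _ := by
        have : √b ≠ 0 := (Real.sqrt_pos.2 hb0).ne'
        field_simp
        ring
  have h4 : (D / b) ^ m ≤ 1 / b ^ 3 := by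
    have e : D / b = b ^ (-(η / 2)) := by
      rw [hD, div_eq_iff hb0.ne', ← Real.rpow_add_one hb0.ne']
      congr 1; ring
    rw [e, ← Real.rpow_natCast, ← Real.rpow_mul hb0.le, one_div, ← Real.rpow_natCast b 3,
      ← Real.rpow_neg hb0.le]
    refine Real.rpow_le_rpow_of_exponent_le hb1 ?_
    push_cast
    nlinarith
  have h5 : y * (3 * (D / b) ^ m) ≤ 3 * (90 * s) ^ 3 := by
    calc y * (3 * (D / b) ^ m) ≤ (90 * s * b) ^ 3 * (3 * (1 / b ^ 3)) := by
          gcongr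
          exact hy.trans (by gcongr)
      _ = _ := by field_simp
  have h6 : (0 : ℝ) ≤ (90 * s) ^ 3 := by positivity
  calc _ ≤ 20 * s * (90 * s) ^ 3 * D + 3 * (90 * s) ^ 3 := add_le_add h2 h5
    _ ≤ 20 * s * (90 * s) ^ 3 * D + 3 * (90 * s) ^ 3 * (s * D) := by
        exact add_le_add le_rfl (le_mul_of_one_le_right (by positivity)
          (one_le_mul_of_one_le_of_one_le hs' hD1))
    _ ≤ _ := by
        have : 0 ≤ (90 * s) ^ 3 * (s * D) := by positivity
        nlinarith

open ShiftRegister in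
theorem eventually_lower_bound {η : ℝ} (hη : 0 < η) (hη1 : η ≤ 1) :
    ∀ᶠ s : ℕ in atTop, ∀ C : MajThrThrCircuit (2 * halfLength s),
      C.Computes (slice output (2 * halfLength s)) →
        (halfLength s : ℝ) ^ ((3 : ℝ) / 2 - η) ≤ (C.gates : ℝ) ∧
          (halfLength s : ℝ) ^ ((5 : ℝ) / 2 - η) ≤ (C.wires : ℝ) := by
  classical
  obtain ⟨m, hm⟩ := exists_nat_ge (6 / η)
  have hm6 : 6 ≤ η * m := by rwa [div_le_iff₀' hη] at hm
  have hm0 : m ≠ 0 := by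
    rintro rfl
    norm_num at hm6
  filter_upwards [eventually_count η hη m, eventually_ge_atTop 1] with s ⟨h₁, h₂⟩ hs C hC
  set n : ℝ := (halfLength s : ℝ) with hn
  have hs' : (1 : ℝ) ≤ s := by exact_mod_cast hs
  have hb1 : (1 : ℝ) ≤ 2 ^ s := one_le_pow₀ (by norm_num)
  have hbn : (2 : ℝ) ^ s ≤ n := by
    rw [hn, halfLength]; push_cast; nlinarith
  have hn1 : 1 ≤ n := hb1.trans hbn
  set D : ℝ := ((2 : ℝ) ^ s) ^ (1 - η / 2) with hD
  have hD0 : 0 < D := by positivity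
  have hDn : D ≤ n := by
    refine le_trans ?_ hbn
    calc D ≤ ((2 : ℝ) ^ s) ^ (1 : ℝ) := Real.rpow_le_rpow_of_exponent_le hb1 (by linarith)
      _ = _ := Real.rpow_one _
  set r : ℕ := ⌊(90 * (s : ℝ)) ^ 4 * D⌋₊ with hr
  have hr1 : (r : ℝ) ≤ (90 * s) ^ 4 * D := Nat.floor_le (by positivity)
  have hr2 : (90 * (s : ℝ)) ^ 4 * D < r + 1 := Nat.lt_floor_add_one _
  have key (htop : (C.top.fanIn : ℝ) ≤ n ^ 3)
      (hx : (Finset.univ.filter fun i => D < (C.bottom i).fanIn).card * D ≤ n ^ ((5 : ℝ) / 2 - η))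
      (hy : ((Finset.univ.filter fun i => (C.bottom i).fanIn ≠ 0).card : ℝ) ≤ n ^ 3) : False := by
    have h := hC.le_of_output (ℓ := 10 * s) (k := 10 * s * (2 * 2 ^ s + 1)) (B := 2 ^ s) (m := m)
      (r := r) (by omega) (by positivity) hm0 hD0 (by positivity)
      (by rw [halfLength]; ring) (count_of_parameters hs hr1 h₁ h₂) htop
    exact (h.trans (sparse_bound hs hη hη1 hm6 hx hy)).not_gt hr2
  have hpow {u : ℝ} (hu : u ≤ 3) : n ^ u ≤ n ^ 3 := by
    rw [← Real.rpow_natCast n 3]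
    exact Real.rpow_le_rpow_of_exponent_le hn1 (by push_cast; exact hu)
  constructor <;> by_contra! hlt
  · refine key ?_ ?_ ?_
    · exact (Nat.cast_le.2 C.top_fanIn_le_gates).trans (hlt.le.trans (hpow (by linarith)))
    · have e : (5 : ℝ) / 2 - η = 3 / 2 - η + 1 := by ring
      rw [e, Real.rpow_add_one (by positivity)]
      exact mul_le_mul ((Nat.cast_le.2 (C.card_filter_bottom_le_gates _)).trans hlt.le) hDn hD0.le
        (by positivity)
    · exact (Nat.cast_le.2 (C.card_filter_bottom_le_gates _)).trans
        (hlt.le.trans (hpow (by linarith)))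
  · refine key ?_ ?_ ?_
    · exact (Nat.cast_le.2 C.top_fanIn_le_wires).trans (hlt.le.trans (hpow (by linarith)))
    · exact (C.card_large_mul_le_wires D).trans hlt.le
    · exact (Nat.cast_le.2 C.card_nonempty_le_wires).trans (hlt.le.trans (hpow (by linarith)))

theorem strictMono_halfLength : StrictMono halfLength := by
  refine strictMono_nat_of_lt_succ fun s => ?_
  rw [halfLength, halfLength, pow_succ]
  have : 0 < 2 ^ s := by positivity
  nlinarith

/-- A sequence along a strictly increasing sequence of indices extends by zero. -/
theorem tendsto_extend_zero {φ : ℕ → ℕ} (hφ : StrictMono φ) {u : ℕ → ℝ}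
    (hu : Tendsto u atTop (𝓝 0)) : Tendsto (Function.extend φ u 0) atTop (𝓝 0) := by
  rw [Metric.tendsto_atTop] at hu ⊢
  intro δ hδ
  obtain ⟨J, hJ⟩ := hu δ hδ
  refine ⟨φ J, fun n hn => ?_⟩
  by_cases h : ∃ j, φ j = n
  · obtain ⟨j, rfl⟩ := h
    rw [hφ.injective.extend_apply]
    exact hJ j (hφ.le_iff_le.1 hn)
  · rw [Function.extend_apply' _ _ _ h]
    simpa using hδ

theorem mainTheorem11 :
    ∃ f : List Bool → Bool, PolyTimeComputable f ∧
      ∃ ε : ℕ → ℝ, Tendsto ε atTop (𝓝 0) ∧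
        ∃ᶠ n : ℕ in atTop, ∀ C : MajThrThrCircuit (2 * n), C.Computes (slice f (2 * n)) →
          (n : ℝ) ^ ((3 : ℝ) / 2 - ε n) ≤ (C.gates : ℝ) ∧
          (n : ℝ) ^ ((5 : ℝ) / 2 - ε n) ≤ (C.wires : ℝ) := by
  obtain ⟨φ, hφ, hbound⟩ := extraction_forall_of_eventually fun j : ℕ =>
    eventually_lower_bound (η := 1 / ((j : ℝ) + 1)) (by positivity)
      ((div_le_one (by positivity)).2 (by linarith [Nat.cast_nonneg (α := ℝ) j]))
  have hmono : StrictMono fun j => halfLength (φ j) := strictMono_halfLength.comp hφ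
  refine ⟨ShiftRegister.output, ShiftRegisterMachine.polyTimeComputable_output,
    Function.extend (fun j => halfLength (φ j)) (fun j => 1 / ((j : ℝ) + 1)) 0,
    tendsto_extend_zero hmono tendsto_one_div_add_atTop_nhds_zero_nat,
    hmono.tendsto_atTop.frequently (Frequently.of_forall fun j C hC => ?_)⟩
  rw [hmono.injective.extend_apply]
  exact hbound j C hC
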